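/- Let $\mathbb D=\{z\in\mathbb C:|z|<1\}$, let $p>1$ and $\alpha>-1$, and let $dA_\alpha(z)=(1+\alpha)(1-|z|^2)^\alpha\,\frac{dx\,dy}{\pi}$ on $\mathbb D$. Let $\mathcal D^p_\alpha$ be the space of all holomorphic functions $f$ on $\mathbb D$ such that $$\|f\|_{\mathcal D^p_\alpha}=\Big(|f(0)|^p+\int_{\mathbb D}|f'(z)|^p\,dA_\alpha(z)\Big)^{1/p}<\infty .$$ Let $\varphi\in\mathcal D^p_\alpha$ satisfy $\varphi(\mathbb D)\subset\mathbb D$, and let $C_\varphi f=f\circ\varphi$. For $\lambda\in\mathbb D$ and $\beta\ge 0$ put $F_{\lambda,\beta}(z)=(1-\overline\lambda z)^{-(1+\beta)}$, $z\in\mathbb D$ (principal branch). Fix $\beta\ge 0$ such that $\delta:=2+\beta-\frac{2+\alpha}{p}>0$. Then: (a) $C_\varphi$ maps $\mathcal D^p_\alpha$ into itself and is bounded there if and only if $\displaystyle\sup_{\lambda\in\mathbb D}(1-|\lambda|^2)^\delta\,\|F_{\lambda,\beta}\circ\varphi\|_{\mathcal D^p_\alpha}<\infty$. (b) $C_\varphi$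 maps $\mathcal D^p_\alpha$ into itself and is compact there if and only if $\displaystyle\lim_{|\lambda|\to1}(1-|\lambda|^2)^\delta\,\|F_{\lambda,\beta}\circ\varphi\|_{\mathcal D^p_\alpha}=0$. -/

import Mathlib

open MeasureTheory Filter Topology
open scoped ENNReal ComplexConjugate Complex.UnitDisc

noncomputable section

namespace WeightedDirichlet

/-- The function on `ℂ` that agrees with `f` on the open unit disc and vanishes elsewhere. It only
serves to speak of holomorphy and of the derivative of `f` at points of the (open) disc. -/
def extendZero (f : 𝔻 → ℂ) (z : ℂ) : ℂ :=
  if h : ‖z‖ < 1 then f (Complex.UnitDisc.mk z h) else 0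

/-- `f` is holomorphic on the open unit disc. -/
def IsHolo (f : 𝔻 → ℂ) : Prop :=
  DifferentiableOn ℂ (extendZero f) (Metric.ball 0 1)

/-- The complex derivative of `f`, meaningful at points of the open unit disc. -/
def derivDisc (f : 𝔻 → ℂ) : ℂ → ℂ := deriv (extendZero f)

/-- The measure `dA_α = (1 + α) (1 - |z|²)^α dx dy / π` on the open unit disc
(as a measure on `ℂ` carried by the disc). -/
def weightedArea (α : ℝ) : Measure ℂ :=
  ((volume : Measure ℂ).restrict (Metric.ball 0 1)).withDensity
    (fun z => ENNReal.ofReal ((1 + α) * (1 - ‖z‖ ^ 2) ^ α / Real.pi))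

/-- The `[0, ∞]`-valued norm `(|f(0)|^p + ∫ |f'|^p dA_α)^(1/p)` of `𝓓^p_α`. -/
def dirichletENorm (p α : ℝ) (f : 𝔻 → ℂ) : ℝ≥0∞ :=
  (‖f 0‖ₑ ^ p + ∫⁻ z, ‖derivDisc f z‖ₑ ^ p ∂(weightedArea α)) ^ (1 / p)

/-- `f ∈ 𝓓^p_α`: `f` is holomorphic on the disc and its `𝓓^p_α` norm is finite. -/
def MemDirichlet (p α : ℝ) (f : 𝔻 → ℂ) : Prop :=
  IsHolo f ∧ dirichletENorm p α f < ∞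

/-- The test function `F_{λ,β}(z) = 1 / (1 - conj λ * z)^(1 + β)` (principal branch; the base has
positive real part). -/
def testFun (l : 𝔻) (β : ℝ) (z : 𝔻) : ℂ :=
  1 / (1 - conj (l : ℂ) * (z : ℂ)) ^ ((1 + β : ℝ) : ℂ)

/-! ### The normed space -/

lemma extendZero_coe (f : 𝔻 → ℂ) (z : 𝔻) : extendZero f z = f z := by
  simp [extendZero, z.norm_lt_one]

lemma extendZero_add (f g : 𝔻 → ℂ) : extendZero (f + g) = extendZero f + extendZero g := by
  funext z
  by_cases h : ‖z‖ < 1 <;> simp [extendZero, h]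

lemma extendZero_smul (c : ℂ) (f : 𝔻 → ℂ) : extendZero (c • f) = c • extendZero f := by
  funext z
  by_cases h : ‖z‖ < 1 <;> simp [extendZero, h]

lemma extendZero_zero : extendZero 0 = 0 := by
  funext z
  by_cases h : ‖z‖ < 1 <;> simp [extendZero, h]

lemma IsHolo.differentiableAt {f : 𝔻 → ℂ} (hf : IsHolo f) {z : ℂ}
    (hz : z ∈ Metric.ball (0 : ℂ) 1) : DifferentiableAt ℂ (extendZero f) z :=
  DifferentiableOn.differentiableAt hf (Metric.isOpen_ball.mem_nhds hz)

lemma weightedArea_ae_mem (α : ℝ) : ∀ᵐ z ∂(weightedArea α), z ∈ Metric.ball (0 : ℂ) 1 :=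
  (withDensity_absolutelyContinuous _ _).ae_le (ae_restrict_mem Metric.isOpen_ball.measurableSet)

lemma measurable_derivDisc (f : 𝔻 → ℂ) : Measurable (derivDisc f) := measurable_deriv _

lemma dirichletENorm_add_le {p : ℝ} (hp : 1 ≤ p) (α : ℝ) {f g : 𝔻 → ℂ} (hf : IsHolo f)
    (hg : IsHolo g) :
    dirichletENorm p α (f + g) ≤ dirichletENorm p α f + dirichletENorm p α g := by
  have hp0 : 0 < p := by linarith
  set μ := weightedArea α
  have key : ∀ h : 𝔻 → ℂ, dirichletENorm p α h =
      (∑ i : Fin 2, (![‖h 0‖ₑ, (∫⁻ z, ‖derivDisc h z‖ₑ ^ p ∂μ) ^ (1 / p)] i) ^ p) ^ (1 / p) := by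
    intro h
    simp only [Fin.sum_univ_two, Matrix.cons_val_zero, Matrix.cons_val_one]
    rw [← ENNReal.rpow_mul, one_div_mul_cancel hp0.ne', ENNReal.rpow_one]
    rfl
  have hint : (∫⁻ z, ‖derivDisc (f + g) z‖ₑ ^ p ∂μ) ^ (1 / p) ≤
      (∫⁻ z, ‖derivDisc f z‖ₑ ^ p ∂μ) ^ (1 / p) + (∫⁻ z, ‖derivDisc g z‖ₑ ^ p ∂μ) ^ (1 / p) := by
    refine le_trans ?_ (ENNReal.lintegral_Lp_add_le (μ := μ)
      (measurable_derivDisc f).enorm.aemeasurable (measurable_derivDisc g).enorm.aemeasurable hp)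
    refine ENNReal.rpow_le_rpow (lintegral_mono_ae ?_) (by positivity)
    filter_upwards [weightedArea_ae_mem α] with z hz
    refine ENNReal.rpow_le_rpow ?_ hp0.le
    simp only [derivDisc, extendZero_add]
    rw [deriv_add (hf.differentiableAt hz) (hg.differentiableAt hz)]
    exact enorm_add_le _ _
  rw [key f, key g, key (f + g)]
  refine le_trans ?_ (ENNReal.Lp_add_le _ _ _ hp)
  refine ENNReal.rpow_le_rpow (Finset.sum_le_sum fun i _ => ?_) (by positivity)
  refine ENNReal.rpow_le_rpow ?_ hp0.le
  fin_cases i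
  · simpa using enorm_add_le (f 0) (g 0)
  · simpa using hint

lemma dirichletENorm_smul {p : ℝ} (hp : 1 ≤ p) (α : ℝ) (c : ℂ) {f : 𝔻 → ℂ} (hf : IsHolo f) :
    dirichletENorm p α (c • f) = ‖c‖ₑ * dirichletENorm p α f := by
  have hp0 : 0 < p := by linarith
  have h1 : ∫⁻ z, ‖derivDisc (c • f) z‖ₑ ^ p ∂(weightedArea α) =
      ‖c‖ₑ ^ p * ∫⁻ z, ‖derivDisc f z‖ₑ ^ p ∂(weightedArea α) := by
    rw [← lintegral_const_mul _ ((measurable_derivDisc f).enorm.pow_const p)]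
    refine lintegral_congr_ae ?_
    filter_upwards [weightedArea_ae_mem α] with z hz
    simp only [derivDisc, extendZero_smul]
    rw [deriv_const_smul c (hf.differentiableAt hz), enorm_smul, ENNReal.mul_rpow_of_nonneg _ _ hp0.le]
  unfold dirichletENorm
  rw [h1, Pi.smul_apply, enorm_smul, ENNReal.mul_rpow_of_nonneg _ _ hp0.le, ← mul_add,
    ENNReal.mul_rpow_of_nonneg _ _ (by positivity), ← ENNReal.rpow_mul, mul_one_div_cancel hp0.ne',
    ENNReal.rpow_one]

lemma dirichletENorm_zero {p : ℝ} (hp : 1 ≤ p) (α : ℝ) : dirichletENorm p α 0 = 0 := by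
  have hp0 : 0 < p := by linarith
  have h : derivDisc 0 = 0 := by
    unfold derivDisc
    rw [extendZero_zero]
    exact deriv_zero
  simp [dirichletENorm, h, hp0]

lemma eq_zero_of_dirichletENorm_eq_zero {p α : ℝ} (hp : 1 ≤ p) (hα : -1 < α) {f : 𝔻 → ℂ}
    (hf : IsHolo f) (h : dirichletENorm p α f = 0) : f = 0 := by
  have hp0 : 0 < p := by linarith
  have hU : IsOpen (Metric.ball (0 : ℂ) 1) := Metric.isOpen_ball
  unfold dirichletENorm at h
  rw [ENNReal.rpow_eq_zero_iff_of_pos (by positivity), add_eq_zero,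
    ENNReal.rpow_eq_zero_iff_of_pos hp0, enorm_eq_zero,
    lintegral_eq_zero_iff ((measurable_derivDisc f).enorm.pow_const p)] at h
  obtain ⟨h0, h1⟩ := h
  have h2 : derivDisc f =ᵐ[(volume : Measure ℂ).restrict (Metric.ball 0 1)] 0 := by
    have h3 := (ae_withDensity_iff (by fun_prop)).1 h1
    filter_upwards [h3, ae_restrict_mem hU.measurableSet] with z hz hzb
    have hz1 : ‖z‖ < 1 := by simpa using hzb
    have : 0 < (1 + α) * (1 - ‖z‖ ^ 2) ^ α / Real.pi := by
      have : 0 < 1 - ‖z‖ ^ 2 := by nlinarith [norm_nonneg z]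
      have : 0 < 1 + α := by linarith
      positivity
    have h4 := hz (by simpa using this)
    simpa [ENNReal.rpow_eq_zero_iff_of_pos hp0] using h4
  have hcont : ContinuousOn (derivDisc f) (Metric.ball 0 1) :=
    (DifferentiableOn.deriv hf hU).continuousOn
  have h3 : Set.EqOn (derivDisc f) 0 (Metric.ball 0 1) :=
    Measure.eqOn_open_of_ae_eq h2 hU hcont continuousOn_const
  funext z
  have h4 := hU.is_const_of_deriv_eq_zero (convex_ball (0 : ℂ) 1).isPreconnected hf h3
    (x := (z : ℂ)) (y := ((0 : 𝔻) : ℂ)) (by simpa using z.norm_lt_one) (by simp)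
  rw [extendZero_coe, extendZero_coe, h0] at h4
  simpa using h4

variable (p α : ℝ) [hp : Fact (1 ≤ p)]

/-- The space `𝓓^p_α` as a linear space of functions on the disc. -/
def dirichletSubmodule : Submodule ℂ (𝔻 → ℂ) where
  carrier := {f | MemDirichlet p α f}
  add_mem' {f g} hf hg := by
    refine ⟨?_, (dirichletENorm_add_le hp.out α hf.1 hg.1).trans_lt (ENNReal.add_lt_top.2 ⟨hf.2, hg.2⟩)⟩
    unfold IsHolo
    rw [extendZero_add]
    exact DifferentiableOn.add hf.1 hg.1
  zero_mem' := by
    refine ⟨?_, by rw [dirichletENorm_zero hp.out]; exact ENNReal.zero_lt_top⟩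
    unfold IsHolo
    rw [extendZero_zero]
    exact differentiableOn_const 0
  smul_mem' c f hf := by
    refine ⟨?_, by rw [dirichletENorm_smul hp.out α c hf.1]; exact ENNReal.mul_lt_top (by simp) hf.2⟩
    unfold IsHolo
    rw [extendZero_smul]
    exact DifferentiableOn.const_smul hf.1 c

/-- The space `𝓓^p_α`. This is not an abbreviation, so that it does not inherit the topology of
pointwise convergence; its topology is the one of the norm below. -/
def DirichletSpace : Type := dirichletSubmodule p α

instance : AddCommGroup (DirichletSpace p α) :=
  inferInstanceAs (AddCommGroup (dirichletSubmodule p α))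

instance : Module ℂ (DirichletSpace p α) :=
  inferInstanceAs (Module ℂ (dirichletSubmodule p α))

instance : CoeFun (DirichletSpace p α) (fun _ => 𝔻 → ℂ) := ⟨fun f => f.1⟩

/-- The norm `‖f‖ = (|f(0)|^p + ∫ |f'|^p dA_α)^(1/p)`, finite on `𝓓^p_α`. -/
instance : Norm (DirichletSpace p α) := ⟨fun f => (dirichletENorm p α f.1).toReal⟩

lemma normedSpaceCore [hα : Fact (-1 < α)] : NormedSpace.Core ℂ (DirichletSpace p α) where
  norm_nonneg _ := ENNReal.toReal_nonneg
  norm_smul c f := by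
    change (dirichletENorm p α (c • f.1)).toReal = ‖c‖ * (dirichletENorm p α f.1).toReal
    rw [dirichletENorm_smul hp.out α c f.2.1]
    simp
  norm_triangle f g := by
    change (dirichletENorm p α (f.1 + g.1)).toReal ≤
      (dirichletENorm p α f.1).toReal + (dirichletENorm p α g.1).toReal
    rw [← ENNReal.toReal_add f.2.2.ne g.2.2.ne]
    exact ENNReal.toReal_mono (ENNReal.add_lt_top.2 ⟨f.2.2, g.2.2⟩).ne
      (dirichletENorm_add_le hp.out α f.2.1 g.2.1)
  norm_eq_zero_iff f := by
    change (dirichletENorm p α f.1).toReal = 0 ↔ f = 0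
    constructor
    · intro h
      rw [ENNReal.toReal_eq_zero_iff, or_iff_left f.2.2.ne] at h
      exact Subtype.ext (eq_zero_of_dirichletENorm_eq_zero hp.out hα.out f.2.1 h)
    · rintro rfl
      change (dirichletENorm p α 0).toReal = 0
      rw [dirichletENorm_zero hp.out]
      simp

instance [Fact (-1 < α)] : NormedAddCommGroup (DirichletSpace p α) :=
  NormedAddCommGroup.ofCore (normedSpaceCore p α)

instance [Fact (-1 < α)] : NormedSpace ℂ (DirichletSpace p α) :=
  NormedSpace.ofCore (normedSpaceCore p α)

/-- `C_φ` maps `𝓓^p_α` into itself and is a bounded operator there: some continuous linear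
operator `T` of `𝓓^p_α` is given by `T f = f ∘ φ`. -/
def CompositionBounded [Fact (-1 < α)] (φ : 𝔻 → 𝔻) : Prop :=
  ∃ T : DirichletSpace p α →L[ℂ] DirichletSpace p α, ∀ f, (T f : 𝔻 → ℂ) = (f : 𝔻 → ℂ) ∘ φ

/-- `C_φ` maps `𝓓^p_α` into itself and is a compact operator there. -/
def CompositionCompact [Fact (-1 < α)] (φ : 𝔻 → 𝔻) : Prop :=
  ∃ T : DirichletSpace p α →L[ℂ] DirichletSpace p α,
    (∀ f, (T f : 𝔻 → ℂ) = (f : 𝔻 → ℂ) ∘ φ) ∧ IsCompactOperator T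

/-- The quantity `(1 - |λ|²)^δ ‖F_{λ,β} ∘ φ‖` with `δ = 2 + β - (2 + α) / p`, where the norm is
that of `𝓓^p_α`, with values in `[0, ∞]`. -/
def testQuantity (p α β : ℝ) (φ : 𝔻 → 𝔻) (l : 𝔻) : ℝ≥0∞ :=
  ENNReal.ofReal ((1 - ‖(l : ℂ)‖ ^ 2) ^ (2 + β - (2 + α) / p)) *
    dirichletENorm p α (testFun l β ∘ φ)

end WeightedDirichlet

end

/-!
For `f` holomorphic, the chain rule turns `∫ |(f ∘ φ)'|^p dA_α` into `∫ |f'|^p dν`, where `ν` is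
the image of `|φ'|^p dA_α` under `φ`. Boundedness of `C_φ` is therefore a Carleson embedding for
`ν` on the Bergman space of the derivatives, and the test quantities are, up to constants and a
term for the value at the origin, `p`-th roots of the transform
`(1 - |w|²)^(q-(2+α)) ∫ |1 - conj w z|^(-q) dν(z)` with `q = (2 + β) p > 2 + α`.

The Forelli–Rudin estimate bounds this transform for `ν = A_α`, so the normalized test functions are
bounded in `𝓓^p_α`; they tend to `0` pointwise as `|λ| → 1`, hence both conditions are necessary.
Conversely, `|f'(z)|^p` is at most its mean over the disc of radius `(1 - |z|) / 2` about `z`, where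
the kernel of the transform times the weight of `dA_α` is comparable to the reciprocal of the area.
Integrating against `ν` and exchanging the integrals bounds the part of `∫ |f'|^p dν` near the unit
circle by the test quantities near the unit circle. Away from the circle `f'` is controlled by the
norm of `f`; for compactness, a bounded sequence has a locally uniformly convergent subsequence by
the Arzelà–Ascoli theorem, and the differences from its limit have derivatives tending to `0` there.
-/

noncomputable section

namespace WeightedDirichlet

open scoped NNReal
open Metric (ball)

section SubMeanValue

lemma lintegral_ball_zero_eq_polar {f : ℂ → ℝ≥0∞} (hf : Measurable f) (R : ℝ) :
    ∫⁻ z in ball 0 R, f z = ∫⁻ r in Set.Ioo 0 R, ENNReal.ofReal r *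
      ∫⁻ θ in Set.Ioo (-Real.pi) Real.pi, f (circleMap 0 r θ) := by
  have hpolar (q : ℝ × ℝ) : Complex.polarCoord.symm q = circleMap 0 q.1 q.2 := by
    simp [circleMap, Complex.exp_mul_I]
  have hmap : Measurable fun q : ℝ × ℝ => circleMap 0 q.1 q.2 := by
    unfold circleMap; fun_prop
  have hball : Measurable ((ball (0 : ℂ) R).indicator f) :=
    hf.indicator Metric.isOpen_ball.measurableSet
  have hcircle : ∀ r ∈ Set.Ioi (0 : ℝ), (∫⁻ θ in Set.Ioo (-Real.pi) Real.pi,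
      ENNReal.ofReal r * (ball (0 : ℂ) R).indicator f (circleMap 0 r θ)) =
      (Set.Iio R).indicator (fun r => ENNReal.ofReal r *
        ∫⁻ θ in Set.Ioo (-Real.pi) Real.pi, f (circleMap 0 r θ)) r := by
    intro r hr
    have hmem (θ : ℝ) : circleMap 0 r θ ∈ ball (0 : ℂ) R ↔ r < R := by
      simp [abs_of_pos (Set.mem_Ioi.1 hr)]
    by_cases hrR : r < R
    · simp only [Set.indicator, hmem, hrR, Set.mem_Iio, if_true]
      exact lintegral_const_mul _ (hf.comp (hmap.comp measurable_prodMk_left))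
    · simp [Set.indicator, hmem, hrR]
  rw [← lintegral_indicator Metric.isOpen_ball.measurableSet,
    ← Complex.lintegral_comp_polarCoord_symm]
  simp_rw [hpolar, smul_eq_mul]
  rw [show polarCoord.target = Set.Ioi (0 : ℝ) ×ˢ Set.Ioo (-Real.pi) Real.pi from rfl,
    Measure.volume_eq_prod, ← Measure.prod_restrict, lintegral_prod _ (by fun_prop),
    setLIntegral_congr_fun measurableSet_Ioi hcircle, setLIntegral_indicator measurableSet_Iio,
    Set.inter_comm, Set.Ioi_inter_Iio]

lemma lintegral_ball_eq_polar {f : ℂ → ℝ≥0∞} (hf : Measurable f) (c : ℂ) (R : ℝ) :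
    ∫⁻ z in ball c R, f z = ∫⁻ r in Set.Ioo 0 R, ENNReal.ofReal r *
      ∫⁻ θ in Set.Ioo (-Real.pi) Real.pi, f (circleMap c r θ) := by
  have htranslate : ∫⁻ z in ball c R, f z = ∫⁻ z in ball 0 R, f (c + z) := by
    rw [← (measurePreserving_add_left volume c).setLIntegral_comp_preimage
      Metric.isOpen_ball.measurableSet hf]
    simp
  rw [htranslate, lintegral_ball_zero_eq_polar (f := fun z => f (c + z)) (by fun_prop)]
  simp [circleMap]

variable {E : Type*} [NormedAddCommGroup E] [NormedSpace ℂ E] [CompleteSpace E]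

lemma enorm_mul_two_pi_le_lintegral_circleMap {g : ℂ → E} {z : ℂ} {r : ℝ} (hr : 0 < r)
    (hg : DiffContOnCl ℂ g (ball z r)) :
    ENNReal.ofReal (2 * Real.pi) * ‖g z‖ₑ ≤
      ∫⁻ θ in Set.Ioo (-Real.pi) Real.pi, ‖g (circleMap z r θ)‖ₑ := by
  have hmean : (2 * Real.pi : ℝ) • g z =
      ∫ θ in Set.Ioo (-Real.pi) Real.pi, g (circleMap z r θ) := by
    rw [← DiffContOnCl.circleAverage (f := g) (R := r) (by rwa [abs_of_pos hr]),
      Real.circleAverage_eq_integral_add (-Real.pi),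
      intervalIntegral.integral_comp_add_right fun θ => g (circleMap z r θ),
      show 0 + -Real.pi = -Real.pi by ring, show 2 * Real.pi + -Real.pi = Real.pi by ring,
      intervalIntegral.integral_of_le (by linarith [Real.pi_pos]), integral_Ioc_eq_integral_Ioo,
      smul_smul, mul_inv_cancel₀ (by positivity), one_smul]
  calc ENNReal.ofReal (2 * Real.pi) * ‖g z‖ₑ = ‖(2 * Real.pi : ℝ) • g z‖ₑ := by
        rw [enorm_smul, Real.enorm_of_nonneg (by positivity)]
    _ ≤ _ := hmean ▸ enorm_integral_le_lintegral_enorm _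

lemma volume_ball_eq_ofReal (z : ℂ) {R : ℝ} (hR : 0 ≤ R) :
    volume (ball z R) = ENNReal.ofReal (Real.pi * R ^ 2) := by
  rw [Complex.volume_ball, mul_comm Real.pi, ENNReal.ofReal_mul (by positivity),
    ENNReal.ofReal_pow hR, ← NNReal.coe_real_pi, ENNReal.ofReal_coe_nnreal]

lemma lintegral_Ioo_zero_ofReal {R : ℝ} (hR : 0 ≤ R) :
    ∫⁻ r in Set.Ioo 0 R, ENNReal.ofReal r = ENNReal.ofReal (R ^ 2 / 2) := by
  rw [← ofReal_integral_eq_lintegral_ofReal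
      (continuous_id'.integrableOn_Icc.mono_set Set.Ioo_subset_Icc_self)
      (by filter_upwards [ae_restrict_mem measurableSet_Ioo] with r hr using hr.1.le),
    ← integral_Ioc_eq_integral_Ioo, ← intervalIntegral.integral_of_le hR]
  simp

lemma volume_ball_mul_enorm_le {g : ℂ → E} {z : ℂ} {R : ℝ} (hR : 0 < R)
    (hg : DifferentiableOn ℂ g (ball z R)) :
    volume (ball z R) * ‖g z‖ₑ ≤ ∫⁻ w in ball z R, ‖g w‖ₑ := by
  have hmeas : Measurable ((ball z R).indicator fun w => ‖g w‖ₑ) := by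
    classical
    rw [← Set.piecewise_eq_indicator]
    exact hg.continuousOn.enorm.measurable_piecewise continuousOn_const
      Metric.isOpen_ball.measurableSet
  have hcircle : ∀ r ∈ Set.Ioo 0 R, ENNReal.ofReal r * (ENNReal.ofReal (2 * Real.pi) * ‖g z‖ₑ) ≤
      ENNReal.ofReal r * ∫⁻ θ in Set.Ioo (-Real.pi) Real.pi,
        (ball z R).indicator (fun w => ‖g w‖ₑ) (circleMap z r θ) := by
    intro r hr
    have hsub : closure (ball z r) ⊆ ball z R := by
      rw [closure_ball z hr.1.ne']
      exact Metric.closedBall_subset_ball hr.2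
    have hmem (θ : ℝ) : circleMap z r θ ∈ ball z R := by
      simpa [dist_eq_norm, abs_of_pos hr.1] using hr.2
    simp only [Set.indicator_of_mem (hmem _)]
    gcongr
    exact enorm_mul_two_pi_le_lintegral_circleMap hr.1 (hg.mono hsub).diffContOnCl
  calc volume (ball z R) * ‖g z‖ₑ
      = ∫⁻ r in Set.Ioo 0 R, ENNReal.ofReal r * (ENNReal.ofReal (2 * Real.pi) * ‖g z‖ₑ) := by
        rw [lintegral_mul_const _ (by fun_prop), lintegral_Ioo_zero_ofReal hR.le, ← mul_assoc,
          ← ENNReal.ofReal_mul (by positivity), volume_ball_eq_ofReal z hR.le]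
        congr 2
        ring
    _ ≤ _ := setLIntegral_mono' measurableSet_Ioo hcircle
    _ = _ := by
        rw [← lintegral_ball_eq_polar hmeas,
          setLIntegral_indicator Metric.isOpen_ball.measurableSet, Set.inter_self]

lemma enorm_rpow_le_laverage_ball {p : ℝ} (hp : 1 ≤ p) {g : ℂ → E} {z : ℂ} {R : ℝ} (hR : 0 < R)
    (hg : DifferentiableOn ℂ g (ball z R)) :
    ‖g z‖ₑ ^ p ≤ ⨍⁻ w in ball z R, ‖g w‖ₑ ^ p ∂volume := by
  have hV0 : volume (ball z R) ≠ 0 := (Metric.measure_ball_pos volume z hR).ne'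
  have hVt : volume (ball z R) ≠ ∞ := measure_ball_lt_top.ne
  have hmeas : AEStronglyMeasurable g (volume.restrict (ball z R)) :=
    hg.continuousOn.aestronglyMeasurable Metric.isOpen_ball.measurableSet
  have : NeZero (volume.restrict (ball z R)) := ⟨by simpa [Measure.restrict_eq_zero] using hV0⟩
  have : IsFiniteMeasure (volume.restrict (ball z R)) := ⟨by simpa using hVt.lt_top⟩
  have hmean : ‖g z‖ₑ ≤ ⨍⁻ w in ball z R, ‖g w‖ₑ ∂volume := by
    rw [setLAverage_eq, ENNReal.le_div_iff_mul_le (.inl hV0) (.inl hVt), mul_comm]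
    exact volume_ball_mul_enorm_le hR hg
  have hjensen := eLpNorm'_le_eLpNorm'_of_exponent_le one_pos hp
    ((volume.restrict (ball z R) Set.univ)⁻¹ • volume.restrict (ball z R)) (hmeas.smul_measure _)
  simp only [eLpNorm', ENNReal.rpow_one, div_one] at hjensen
  calc ‖g z‖ₑ ^ p ≤ ((⨍⁻ w in ball z R, ‖g w‖ₑ ^ p ∂volume) ^ (1 / p)) ^ p := by
        gcongr
        exact hmean.trans hjensen
    _ = _ := by rw [← ENNReal.rpow_mul, one_div_mul_cancel (by positivity), ENNReal.rpow_one]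

end SubMeanValue

section ForelliRudin

lemma lintegral_Ioc_zero_rpow {α a : ℝ} (hα : -1 < α) (ha : 0 ≤ a) :
    ∫⁻ t in Set.Ioc 0 a, ENNReal.ofReal (t ^ α) = ENNReal.ofReal (a ^ (α + 1) / (α + 1)) := by
  rw [← ofReal_integral_eq_lintegral_ofReal (intervalIntegral.intervalIntegrable_rpow' hα).1
      (by filter_upwards [ae_restrict_mem measurableSet_Ioc] with t ht using
        Real.rpow_nonneg ht.1.le _),
    ← intervalIntegral.integral_of_le ha, integral_rpow (.inl hα), Real.zero_rpow (by linarith),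
    sub_zero]

lemma lintegral_Ioi_rpow {k a : ℝ} (hk : k < -1) (ha : 0 < a) :
    ∫⁻ t in Set.Ioi a, ENNReal.ofReal (t ^ k) = ENNReal.ofReal (-a ^ (k + 1) / (k + 1)) := by
  rw [← ofReal_integral_eq_lintegral_ofReal (integrableOn_Ioi_rpow_of_lt hk ha)
      (by filter_upwards [ae_restrict_mem measurableSet_Ioi] with t ht using
        Real.rpow_nonneg (ha.trans ht).le _),
    integral_Ioi_rpow_of_lt hk ha]

lemma lintegral_rpow_mul_max_rpow {α k a : ℝ} (hα : -1 < α) (hk : α + 1 < k) (ha : 0 < a) :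
    ∫⁻ t in Set.Ioi 0, ENNReal.ofReal (t ^ α * max a t ^ (-k)) =
      ENNReal.ofReal ((1 / (α + 1) + 1 / (k - α - 1)) * a ^ (α + 1 - k)) := by
  have hα₀ : 0 < α + 1 := by linarith
  have hk₀ : 0 < k - α - 1 := by linarith
  have hnear : ∫⁻ t in Set.Ioc 0 a, ENNReal.ofReal (t ^ α * max a t ^ (-k)) =
      ENNReal.ofReal (1 / (α + 1) * a ^ (α + 1 - k)) := by
    have hmax : ∀ t ∈ Set.Ioc 0 a, ENNReal.ofReal (t ^ α * max a t ^ (-k)) =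
        ENNReal.ofReal (t ^ α) * ENNReal.ofReal (a ^ (-k)) := fun t ht => by
      rw [max_eq_left ht.2, ENNReal.ofReal_mul (Real.rpow_nonneg ht.1.le _)]
    rw [setLIntegral_congr_fun measurableSet_Ioc hmax, lintegral_mul_const _ (by fun_prop),
      lintegral_Ioc_zero_rpow hα ha.le, ← ENNReal.ofReal_mul (by positivity), sub_eq_add_neg _ k,
      Real.rpow_add ha (α + 1)]
    ring_nf
  have hfar : ∫⁻ t in Set.Ioi a, ENNReal.ofReal (t ^ α * max a t ^ (-k)) =
      ENNReal.ofReal (1 / (k - α - 1) * a ^ (α + 1 - k)) := by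
    have hmax : ∀ t ∈ Set.Ioi a, ENNReal.ofReal (t ^ α * max a t ^ (-k)) =
        ENNReal.ofReal (t ^ (α - k)) := fun t ht => by
      rw [max_eq_right (le_of_lt ht), ← Real.rpow_add (ha.trans ht), sub_eq_add_neg]
    rw [setLIntegral_congr_fun measurableSet_Ioi hmax, lintegral_Ioi_rpow (by linarith) ha,
      show α - k + 1 = α + 1 - k by ring, neg_div, ← div_neg, show -(α + 1 - k) = k - α - 1 by ring,
      one_div_mul_eq_div]
  rw [← Set.Ioc_union_Ioi_eq_Ioi ha.le,
    lintegral_union measurableSet_Ioi (Set.Ioc_disjoint_Ioi le_rfl), hnear, hfar,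
    ← ENNReal.ofReal_add (by positivity) (by positivity), add_mul]

lemma lintegral_comp_abs (f : ℝ → ℝ≥0∞) :
    ∫⁻ x, f |x| = 2 * ∫⁻ x in Set.Ioi 0, f x := by
  have hpos : ∫⁻ x in Set.Ioi 0, f |x| = ∫⁻ x in Set.Ioi 0, f x :=
    setLIntegral_congr_fun measurableSet_Ioi fun x hx => by rw [abs_of_pos hx]
  have hneg : ∫⁻ x in Set.Iic 0, f |x| = ∫⁻ x in Set.Ioi 0, f |x| := by
    rw [← setLIntegral_congr Ioi_ae_eq_Ici.symm, ← (Measure.measurePreserving_neg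
      (volume : Measure ℝ)).setLIntegral_comp_preimage_emb (Homeomorph.neg ℝ).measurableEmbedding]
    simp
  rw [← lintegral_add_compl _ measurableSet_Ioi, Set.compl_Ioi, hneg, hpos, two_mul]

lemma two_div_pi_mul_abs_le_norm_one_sub_circleMap {θ : ℝ} (hθ : |θ| ≤ Real.pi) :
    2 / Real.pi * |θ| ≤ ‖1 - circleMap 0 1 θ‖ := by
  have hchord : ‖1 - circleMap 0 1 θ‖ = 2 * |Real.sin (θ / 2)| := by
    have := Complex.norm_exp_I_mul_ofReal_sub_one θ
    rw [norm_mul, Real.norm_two, Real.norm_eq_abs] at this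
    rw [norm_sub_rev, ← this]
    simp [circleMap, mul_comm]
  have hsin := Real.mul_abs_le_abs_sin (x := θ / 2) (by rw [abs_div, abs_two]; linarith)
  rw [abs_div, abs_two] at hsin
  linarith

lemma max_le_pi_mul_norm_one_sub_circleMap {ρ θ : ℝ} (h0 : 0 ≤ ρ) (h1 : ρ ≤ 1)
    (hθ : |θ| ≤ Real.pi) : max (1 - ρ) |θ| ≤ Real.pi * ‖1 - circleMap 0 ρ θ‖ := by
  have hradial : 1 - ρ ≤ ‖1 - circleMap 0 ρ θ‖ := by
    simpa [abs_of_nonneg h0] using norm_sub_norm_le (1 : ℂ) (circleMap 0 ρ θ)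
  have hunit : ‖1 - circleMap 0 1 θ‖ ≤ 2 * ‖1 - circleMap 0 ρ θ‖ := by
    have hdist : ‖((1 - ρ : ℝ) : ℂ) * circleMap 0 1 θ‖ = 1 - ρ := by
      simp [-Complex.ofReal_sub, abs_of_nonneg (sub_nonneg.2 h1)]
    have hsplit : (1 : ℂ) - circleMap 0 1 θ =
        (1 - circleMap 0 ρ θ) - ((1 - ρ : ℝ) : ℂ) * circleMap 0 1 θ := by
      simp only [circleMap, zero_add, Complex.ofReal_one, Complex.ofReal_sub, one_mul]
      ring
    rw [hsplit]
    linarith [norm_sub_le (1 - circleMap 0 ρ θ) (((1 - ρ : ℝ) : ℂ) * circleMap 0 1 θ)]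
  refine max_le (by nlinarith [Real.pi_gt_three]) ?_
  have hchord := (two_div_pi_mul_abs_le_norm_one_sub_circleMap hθ).trans hunit
  rw [div_mul_eq_mul_div, div_le_iff₀ Real.pi_pos] at hchord
  linarith

lemma lintegral_norm_one_sub_circleMap_rpow_le {c ρ : ℝ} (hc : 1 < c) (h0 : 0 ≤ ρ) (h1 : ρ < 1) :
    ∫⁻ θ in Set.Ioo (-Real.pi) Real.pi, ENNReal.ofReal (‖1 - circleMap 0 ρ θ‖ ^ (-c)) ≤
      ENNReal.ofReal (2 * Real.pi ^ c * (1 + 1 / (c - 1)) * (1 - ρ) ^ (1 - c)) := by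
  have ha : 0 < 1 - ρ := by linarith
  have hpi := Real.pi_pos
  have hpointwise : ∀ θ ∈ Set.Ioo (-Real.pi) Real.pi,
      ENNReal.ofReal (‖1 - circleMap 0 ρ θ‖ ^ (-c)) ≤
        ENNReal.ofReal (Real.pi ^ c) * ENNReal.ofReal (max (1 - ρ) |θ| ^ (-c)) := by
    intro θ hθ
    have hmax : 0 < max (1 - ρ) |θ| := lt_max_of_lt_left ha
    have hle : max (1 - ρ) |θ| / Real.pi ≤ ‖1 - circleMap 0 ρ θ‖ := by
      rw [div_le_iff₀' hpi]
      exact max_le_pi_mul_norm_one_sub_circleMap h0 h1.le (abs_le.2 ⟨hθ.1.le, hθ.2.le⟩)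
    rw [← ENNReal.ofReal_mul (by positivity)]
    gcongr
    calc ‖1 - circleMap 0 ρ θ‖ ^ (-c) ≤ (max (1 - ρ) |θ| / Real.pi) ^ (-c) :=
          Real.rpow_le_rpow_of_nonpos (by positivity) hle (by linarith)
      _ = _ := by
          rw [Real.div_rpow hmax.le hpi.le, Real.rpow_neg hpi.le, div_inv_eq_mul, mul_comm]
  have hline : ∫⁻ θ, ENNReal.ofReal (max (1 - ρ) |θ| ^ (-c)) =
      2 * ENNReal.ofReal ((1 + 1 / (c - 1)) * (1 - ρ) ^ (1 - c)) := by
    rw [lintegral_comp_abs fun t => ENNReal.ofReal (max (1 - ρ) t ^ (-c))]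
    simpa using congrArg (2 * ·)
      (lintegral_rpow_mul_max_rpow (α := 0) (k := c) (by norm_num) (by linarith) ha)
  calc _ ≤ ∫⁻ θ in Set.Ioo (-Real.pi) Real.pi,
          ENNReal.ofReal (Real.pi ^ c) * ENNReal.ofReal (max (1 - ρ) |θ| ^ (-c)) :=
        setLIntegral_mono' measurableSet_Ioo hpointwise
    _ ≤ _ := setLIntegral_le_lintegral _ _
    _ = _ := by
        rw [lintegral_const_mul _ (by fun_prop), hline, ← ENNReal.ofReal_ofNat,
          ← ENNReal.ofReal_mul (by norm_num), ← ENNReal.ofReal_mul (by positivity)]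
        ring_nf

lemma lintegral_weightedArea (α : ℝ) (f : ℂ → ℝ≥0∞) :
    ∫⁻ z, f z ∂(weightedArea α) = ∫⁻ z in ball 0 1,
      ENNReal.ofReal ((1 + α) * (1 - ‖z‖ ^ 2) ^ α / Real.pi) * f z := by
  rw [weightedArea, lintegral_withDensity_eq_lintegral_mul_non_measurable _ (by fun_prop)
    (.of_forall fun _ => ENNReal.ofReal_lt_top)]
  rfl

lemma lintegral_weightedArea_comp_mul_left (α : ℝ) (a : Circle) (f : ℂ → ℝ≥0∞) :
    ∫⁻ z, f (a * z) ∂(weightedArea α) = ∫⁻ z, f z ∂(weightedArea α) := by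
  simp only [lintegral_weightedArea]
  simpa [Circle.norm_coe, map_zero] using
    (rotation a).measurePreserving.setLIntegral_comp_preimage_emb
    (rotation a).toHomeomorph.measurableEmbedding
    (fun z => ENNReal.ofReal ((1 + α) * (1 - ‖z‖ ^ 2) ^ α / Real.pi) * f z) (ball 0 1)

lemma one_sub_sq_rpow_le (α : ℝ) {r : ℝ} (h0 : 0 ≤ r) (h1 : r ≤ 1) :
    (1 - r ^ 2) ^ α ≤ 2 ^ |α| * (1 - r) ^ α := by
  rw [show 1 - r ^ 2 = (1 + r) * (1 - r) by ring, Real.mul_rpow (by linarith) (by linarith)]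
  gcongr
  calc (1 + r) ^ α ≤ (1 + r) ^ |α| :=
        Real.rpow_le_rpow_of_exponent_le (by linarith) (le_abs_self α)
    _ ≤ _ := Real.rpow_le_rpow (by linarith) (by linarith) (abs_nonneg α)

lemma lintegral_Ioo_zero_one_comp_one_sub (f : ℝ → ℝ≥0∞) :
    ∫⁻ r in Set.Ioo 0 1, f (1 - r) = ∫⁻ t in Set.Ioo 0 1, f t := by
  rw [← (volume.measurePreserving_sub_left (1 : ℝ)).setLIntegral_comp_preimage_emb
    (Homeomorph.subLeft 1).measurableEmbedding]
  simp

lemma lintegral_circleMap_weight_mul_rpow_le {α q ρ r : ℝ} (hα : -1 < α) (hq : 1 < q) (h0 : 0 ≤ ρ)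
    (h1 : ρ < 1) (hr : r ∈ Set.Ioo (0 : ℝ) 1) :
    ENNReal.ofReal r * ∫⁻ θ in Set.Ioo (-Real.pi) Real.pi,
        ENNReal.ofReal ((1 + α) * (1 - ‖circleMap 0 r θ‖ ^ 2) ^ α / Real.pi) *
          ENNReal.ofReal (‖1 - ρ * circleMap 0 r θ‖ ^ (-q)) ≤
      ENNReal.ofReal ((1 + α) * 2 ^ |α| / Real.pi * (2 * Real.pi ^ q * (1 + 1 / (q - 1)))) *
        ENNReal.ofReal ((1 - r) ^ α * max (1 - ρ) (1 - r) ^ (-(q - 1))) := by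
  have hα₀ : 0 < 1 + α := by linarith
  have hr₀ : 0 < 1 - r := by linarith [hr.2]
  have hρ₀ : 0 < 1 - ρ := by linarith
  have hrρ : ρ * r < 1 := by nlinarith [hr.1, hr.2]
  have hcircle (θ : ℝ) : (ρ : ℂ) * circleMap 0 r θ = circleMap 0 (ρ * r) θ := by
    simp [circleMap, mul_assoc]
  have hweight : (1 + α) * (1 - r ^ 2) ^ α / Real.pi ≤
      (1 + α) * 2 ^ |α| / Real.pi * (1 - r) ^ α := by
    calc _ ≤ (1 + α) * (2 ^ |α| * (1 - r) ^ α) / Real.pi := by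
          gcongr
          exact one_sub_sq_rpow_le α hr.1.le hr.2.le
      _ = _ := by ring
  have hmax : (1 - ρ * r) ^ (1 - q) ≤ max (1 - ρ) (1 - r) ^ (-(q - 1)) := by
    rw [neg_sub]
    refine Real.rpow_le_rpow_of_nonpos (lt_max_of_lt_left hρ₀) (max_le ?_ ?_) (by linarith)
    · nlinarith [hr.2]
    · nlinarith [hr.1]
  simp_rw [norm_circleMap_zero, abs_of_pos hr.1, hcircle]
  rw [lintegral_const_mul _ (by unfold circleMap; fun_prop), mul_left_comm,
    ← ENNReal.ofReal_mul (by positivity), mul_mul_mul_comm, ENNReal.ofReal_mul (by positivity)]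
  refine mul_le_mul' (ENNReal.ofReal_le_ofReal hweight) ?_
  calc _ ≤ 1 * ∫⁻ θ in Set.Ioo (-Real.pi) Real.pi,
          ENNReal.ofReal (‖1 - circleMap 0 (ρ * r) θ‖ ^ (-q)) := by
        gcongr
        simpa using hr.2.le
    _ ≤ _ := by
        rw [one_mul]
        exact (lintegral_norm_one_sub_circleMap_rpow_le hq (mul_nonneg h0 hr.1.le) hrρ).trans
          (by gcongr)

/-- The weighted Berezin-type transform `(1 - |w|²)^(q-(2+α)) ∫ |1 - conj w z|^(-q) dν(z)` of a
measure `ν` on the disc. Its boundedness, respectively its decay at the unit circle, says that `ν`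
is a Carleson measure, respectively a vanishing one, for the Bergman space of `dA_α`. -/
def berezinTransform (α q : ℝ) (ν : Measure ℂ) (w : ℂ) : ℝ≥0∞ :=
  ENNReal.ofReal ((1 - ‖w‖ ^ 2) ^ (q - (2 + α))) *
    ∫⁻ z, ENNReal.ofReal (‖1 - conj w * z‖ ^ (-q)) ∂ν

lemma lintegral_weightedArea_kernel_eq_norm (α q : ℝ) (w : ℂ) :
    ∫⁻ z, ENNReal.ofReal (‖1 - conj w * z‖ ^ (-q)) ∂(weightedArea α) =
      ∫⁻ z, ENNReal.ofReal (‖1 - ‖w‖ * z‖ ^ (-q)) ∂(weightedArea α) := by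
  have hrotate : conj w * (Circle.exp w.arg : ℂ) = ‖w‖ := by
    conv_lhs => rw [← Complex.norm_mul_exp_arg_mul_I w]
    rw [map_mul, Complex.conj_ofReal, ← Complex.exp_conj, Circle.coe_exp, mul_assoc,
      ← Complex.exp_add]
    simp
  rw [← lintegral_weightedArea_comp_mul_left α (Circle.exp w.arg)]
  simp_rw [← mul_assoc, hrotate]

lemma exists_berezinTransform_weightedArea_le {α q : ℝ} (hα : -1 < α) (hq : 2 + α < q) :
    ∃ C : ℝ≥0, ∀ w : ℂ, ‖w‖ < 1 → berezinTransform α q (weightedArea α) w ≤ C := by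
  set A := (1 + α) * 2 ^ |α| / Real.pi * (2 * Real.pi ^ q * (1 + 1 / (q - 1)))
  set B := 1 / (α + 1) + 1 / (q - 1 - α - 1) with hB
  have hB₀ : 0 ≤ B := by
    have : 0 < α + 1 := by linarith
    have : 0 < q - 1 - α - 1 := by linarith
    positivity
  refine ⟨(2 ^ |q - (2 + α)| * (A * B)).toNNReal, fun w hw => ?_⟩
  have hw₀ : 0 < 1 - ‖w‖ := by linarith
  calc berezinTransform α q (weightedArea α) w
    _ ≤ ENNReal.ofReal (2 ^ |q - (2 + α)| * (1 - ‖w‖) ^ (q - (2 + α))) *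
        ∫⁻ r in Set.Ioo 0 1, ENNReal.ofReal A *
          ENNReal.ofReal ((1 - r) ^ α * max (1 - ‖w‖) (1 - r) ^ (-(q - 1))) := by
        rw [berezinTransform, lintegral_weightedArea_kernel_eq_norm, lintegral_weightedArea,
          lintegral_ball_zero_eq_polar (by fun_prop)]
        gcongr ENNReal.ofReal ?_ * ?_
        · exact one_sub_sq_rpow_le _ (norm_nonneg w) hw.le
        · exact setLIntegral_mono' measurableSet_Ioo fun r hr =>
            lintegral_circleMap_weight_mul_rpow_le hα (by linarith) (norm_nonneg w) hw hr
    _ ≤ ENNReal.ofReal (2 ^ |q - (2 + α)| * (1 - ‖w‖) ^ (q - (2 + α))) * (ENNReal.ofReal A *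
        ∫⁻ t in Set.Ioi 0, ENNReal.ofReal (t ^ α * max (1 - ‖w‖) t ^ (-(q - 1)))) := by
        rw [lintegral_const_mul _ (by fun_prop), lintegral_Ioo_zero_one_comp_one_sub
          fun t => ENNReal.ofReal (t ^ α * max (1 - ‖w‖) t ^ (-(q - 1)))]
        gcongr
        exact Set.Ioo_subset_Ioi_self
    _ = ENNReal.ofReal (2 ^ |q - (2 + α)| * (A * B)) := by
        rw [lintegral_rpow_mul_max_rpow hα (by linarith) hw₀, ← hB,
          ← ENNReal.ofReal_mul' (by positivity), ← ENNReal.ofReal_mul (by positivity),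
          show α + 1 - (q - 1) = -(q - (2 + α)) by ring, Real.rpow_neg hw₀.le]
        field_simp

end ForelliRudin

section Carleson

instance (α : ℝ) : SFinite (weightedArea α) := by
  unfold weightedArea; infer_instance

lemma setLIntegral_weightedArea (α : ℝ) {s : Set ℂ} (hs : MeasurableSet s) (hsub : s ⊆ ball 0 1)
    (f : ℂ → ℝ≥0∞) :
    ∫⁻ z in s, f z ∂(weightedArea α) =
      ∫⁻ z in s, ENNReal.ofReal ((1 + α) * (1 - ‖z‖ ^ 2) ^ α / Real.pi) * f z := by
  rw [weightedArea, restrict_withDensity hs, Measure.restrict_restrict hs,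
    Set.inter_eq_left.2 hsub, lintegral_withDensity_eq_lintegral_mul_non_measurable _ (by fun_prop)
      (.of_forall fun _ => ENNReal.ofReal_lt_top)]
  rfl

lemma half_one_sub_norm_lt {z w : ℂ} (h : dist w z < (1 - ‖z‖) / 2) :
    (1 - ‖z‖) / 2 < 1 - ‖w‖ := by
  rw [dist_eq_norm] at h
  linarith [norm_le_norm_add_norm_sub' w z]

lemma one_sub_norm_lt {z w : ℂ} (h : dist w z < (1 - ‖z‖) / 2) :
    1 - ‖w‖ < 3 / 2 * (1 - ‖z‖) := by
  rw [dist_eq_norm] at h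
  linarith [norm_le_norm_add_norm_sub w z]

lemma ball_half_one_sub_norm_subset (z : ℂ) : ball z ((1 - ‖z‖) / 2) ⊆ ball 0 1 := by
  intro w hw
  have hpos : 0 < (1 - ‖z‖) / 2 := dist_nonneg.trans_lt hw
  have := half_one_sub_norm_lt hw
  rw [mem_ball_zero_iff]
  linarith

lemma one_sub_norm_le_norm_one_sub_conj_mul (z : ℂ) {w : ℂ} (hw : ‖w‖ ≤ 1) :
    1 - ‖z‖ ≤ ‖1 - conj w * z‖ := by
  have h := norm_sub_norm_le (1 : ℂ) (conj w * z)
  rw [norm_mul, RCLike.norm_conj, norm_one] at h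
  nlinarith [norm_nonneg z]

lemma norm_one_sub_conj_mul_le {z w : ℂ} (h : dist w z < (1 - ‖z‖) / 2) :
    ‖1 - conj w * z‖ ≤ 2 * (1 - ‖w‖ ^ 2) := by
  have hw := half_one_sub_norm_lt h
  rw [dist_eq_norm] at h
  have hw₀ := norm_nonneg w
  have hdist₀ := norm_nonneg (w - z)
  have hsq : ((1 - ‖w‖ ^ 2 : ℝ) : ℂ) + conj w * (w - z) = 1 - conj w * z := by
    rw [mul_sub, Complex.conj_mul']
    push_cast
    ring
  calc ‖1 - conj w * z‖ ≤ ‖((1 - ‖w‖ ^ 2 : ℝ) : ℂ)‖ + ‖conj w * (w - z)‖ := hsq ▸ norm_add_le _ _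
    _ = 1 - ‖w‖ ^ 2 + ‖w‖ * ‖w - z‖ := by
        rw [Complex.norm_real, Real.norm_of_nonneg (by nlinarith), norm_mul, RCLike.norm_conj]
    _ ≤ _ := by nlinarith

lemma inv_pi_mul_sq_le_kernel {α q : ℝ} (hα : -1 < α) (hq : 0 ≤ q) {z w : ℂ}
    (h : dist w z < (1 - ‖z‖) / 2) :
    (Real.pi * ((1 - ‖z‖) / 2) ^ 2)⁻¹ ≤ 36 * 2 ^ q / (1 + α) *
      ((1 + α) * (1 - ‖w‖ ^ 2) ^ α / Real.pi *
        ((1 - ‖w‖ ^ 2) ^ (q - (2 + α)) * ‖1 - conj w * z‖ ^ (-q))) := by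
  have hz : 0 < 1 - ‖z‖ := by linarith [dist_nonneg.trans_lt h]
  have hw := half_one_sub_norm_lt h
  have hw₀ := norm_nonneg w
  have hα₀ : 0 < 1 + α := by linarith
  have hx : 0 < 1 - ‖w‖ ^ 2 := by nlinarith
  have hx_le : 1 - ‖w‖ ^ 2 ≤ 3 * (1 - ‖z‖) := by nlinarith [one_sub_norm_lt h]
  have hk : 0 < ‖1 - conj w * z‖ :=
    hz.trans_le (one_sub_norm_le_norm_one_sub_conj_mul z (by linarith))
  have hkernel : 1 ≤ 2 ^ q * ((1 - ‖w‖ ^ 2) ^ q * ‖1 - conj w * z‖ ^ (-q)) := by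
    rw [← mul_assoc, ← Real.mul_rpow zero_le_two hx.le, Real.rpow_neg hk.le, ← div_eq_mul_inv,
      one_le_div (by positivity)]
    exact Real.rpow_le_rpow hk.le (norm_one_sub_conj_mul_le h) hq
  calc (Real.pi * ((1 - ‖z‖) / 2) ^ 2)⁻¹ = 36 * (Real.pi * (3 * (1 - ‖z‖)) ^ 2)⁻¹ := by
        field_simp; norm_num
    _ ≤ 36 * (Real.pi * (1 - ‖w‖ ^ 2) ^ 2)⁻¹ := by gcongr
    _ ≤ 36 * (Real.pi * (1 - ‖w‖ ^ 2) ^ 2)⁻¹ *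
        (2 ^ q * ((1 - ‖w‖ ^ 2) ^ q * ‖1 - conj w * z‖ ^ (-q))) :=
        le_mul_of_one_le_right (by positivity) hkernel
    _ = _ := by
        have hsplit : (1 - ‖w‖ ^ 2) ^ q =
            (1 - ‖w‖ ^ 2) ^ 2 * ((1 - ‖w‖ ^ 2) ^ α * (1 - ‖w‖ ^ 2) ^ (q - (2 + α))) := by
          conv_lhs => rw [show q = (2 : ℝ) + (α + (q - (2 + α))) by ring]
          rw [Real.rpow_add hx, Real.rpow_add hx, Real.rpow_two]
        rw [hsplit]
        field_simp

variable {E : Type*} [NormedAddCommGroup E]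

lemma aemeasurable_enorm_weightedArea (α : ℝ) {g : ℂ → E} (hg : ContinuousOn g (ball 0 1)) :
    AEMeasurable (fun w => ‖g w‖ₑ) (weightedArea α) :=
  (hg.enorm.aemeasurable Metric.isOpen_ball.measurableSet).mono_ac
    (withDensity_absolutelyContinuous _ _)

variable [NormedSpace ℂ E] [CompleteSpace E] {p α q : ℝ}

lemma exists_enorm_rpow_le_lintegral_kernel (hp : 1 ≤ p) (hα : -1 < α) (hq : 0 ≤ q) :
    ∃ C : ℝ≥0, ∀ g : ℂ → E, DifferentiableOn ℂ g (ball 0 1) → ∀ z : ℂ, ‖z‖ < 1 →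
      ‖g z‖ₑ ^ p ≤ C * ∫⁻ w in ball z ((1 - ‖z‖) / 2),
        ENNReal.ofReal ((1 - ‖w‖ ^ 2) ^ (q - (2 + α)) * ‖1 - conj w * z‖ ^ (-q)) * ‖g w‖ₑ ^ p
          ∂(weightedArea α) := by
  refine ⟨(36 * 2 ^ q / (1 + α)).toNNReal, fun g hg z hz => ?_⟩
  have hr : 0 < (1 - ‖z‖) / 2 := by linarith
  have hα₀ : 0 < 1 + α := by linarith
  have hsub := ball_half_one_sub_norm_subset z
  rw [setLIntegral_weightedArea α Metric.isOpen_ball.measurableSet hsub]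
  calc ‖g z‖ₑ ^ p ≤ ⨍⁻ w in ball z ((1 - ‖z‖) / 2), ‖g w‖ₑ ^ p ∂volume :=
        enorm_rpow_le_laverage_ball hp hr (hg.mono hsub)
    _ = ∫⁻ w in ball z ((1 - ‖z‖) / 2),
          ENNReal.ofReal (Real.pi * ((1 - ‖z‖) / 2) ^ 2)⁻¹ * ‖g w‖ₑ ^ p := by
        rw [lintegral_const_mul' _ _ ENNReal.ofReal_ne_top, setLAverage_eq,
          volume_ball_eq_ofReal z hr.le, ENNReal.ofReal_inv_of_pos (by positivity),
          ENNReal.div_eq_inv_mul]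
    _ ≤ ∫⁻ w in ball z ((1 - ‖z‖) / 2), ENNReal.ofReal (36 * 2 ^ q / (1 + α) *
          ((1 + α) * (1 - ‖w‖ ^ 2) ^ α / Real.pi *
            ((1 - ‖w‖ ^ 2) ^ (q - (2 + α)) * ‖1 - conj w * z‖ ^ (-q)))) * ‖g w‖ₑ ^ p :=
        setLIntegral_mono' Metric.isOpen_ball.measurableSet fun w hw => by
          gcongr
          exact inv_pi_mul_sq_le_kernel hα hq hw
    _ = _ := by
        rw [← lintegral_const_mul' _ _ ENNReal.coe_ne_top]
        refine setLIntegral_congr_fun Metric.isOpen_ball.measurableSet fun w hw => ?_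
        have hw₁ : 0 ≤ 1 - ‖w‖ ^ 2 := by
          nlinarith [norm_nonneg w, mem_ball_zero_iff.1 (hsub hw)]
        rw [ENNReal.ofReal_mul (by positivity), ENNReal.ofReal_mul (by positivity), mul_assoc,
          mul_assoc]
        rfl

lemma exists_enorm_rpow_le_lintegral_weightedArea (hp : 1 ≤ p) (hα : -1 < α) {R : ℝ} (hR : R < 1) :
    ∃ C : ℝ≥0, ∀ g : ℂ → E, DifferentiableOn ℂ g (ball 0 1) → ∀ z : ℂ, ‖z‖ ≤ R →
      ‖g z‖ₑ ^ p ≤ C * ∫⁻ w, ‖g w‖ₑ ^ p ∂(weightedArea α) := by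
  obtain ⟨C, hC⟩ := exists_enorm_rpow_le_lintegral_kernel (E := E) hp hα
    (show 0 ≤ 2 + α by linarith)
  refine ⟨C * ((1 - R) ^ (-(2 + α))).toNNReal, fun g hg z hz => (hC g hg z (by linarith)).trans ?_⟩
  rw [ENNReal.coe_mul, mul_assoc,
    ← lintegral_const_mul' ((1 - R) ^ (-(2 + α))).toNNReal _ ENNReal.coe_ne_top]
  refine mul_le_mul_right ?_ _
  refine (setLIntegral_mono' Metric.isOpen_ball.measurableSet fun w hw => ?_).trans
    (setLIntegral_le_lintegral _ _)
  have hw : ‖w‖ < 1 := mem_ball_zero_iff.1 (ball_half_one_sub_norm_subset z hw)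
  rw [sub_self, Real.rpow_zero, one_mul]
  gcongr
  refine ENNReal.ofReal_le_ofReal (Real.rpow_le_rpow_of_nonpos (by linarith) ?_ (by linarith))
  linarith [one_sub_norm_le_norm_one_sub_conj_mul z hw.le]

lemma exists_lintegral_compl_ball_le_berezinTransform (hp : 1 ≤ p) (hα : -1 < α) (hq : 0 ≤ q) :
    ∃ C : ℝ≥0, ∀ (ν : Measure ℂ) [SFinite ν], (∀ᵐ z ∂ν, ‖z‖ < 1) →
      ∀ g : ℂ → E, DifferentiableOn ℂ g (ball 0 1) → ∀ ρ : ℝ,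
        ∫⁻ z in (ball 0 ((1 + 2 * ρ) / 3))ᶜ, ‖g z‖ₑ ^ p ∂ν ≤
          C * ∫⁻ w in {w | ρ ≤ ‖w‖}, berezinTransform α q ν w * ‖g w‖ₑ ^ p ∂(weightedArea α) := by
  obtain ⟨C, hC⟩ := exists_enorm_rpow_le_lintegral_kernel (E := E) hp hα hq
  refine ⟨C, fun ν _ hν g hg ρ => ?_⟩
  set k : ℂ → ℂ → ℝ≥0∞ := fun z w =>
    ENNReal.ofReal ((1 - ‖w‖ ^ 2) ^ (q - (2 + α)) * ‖1 - conj w * z‖ ^ (-q)) * ‖g w‖ₑ ^ p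
  have hk : AEMeasurable (Function.uncurry k)
      ((ν.restrict (ball 0 ((1 + 2 * ρ) / 3))ᶜ).prod
        ((weightedArea α).restrict {w | ρ ≤ ‖w‖})) :=
    AEMeasurable.mul (by fun_prop)
      (((aemeasurable_enorm_weightedArea α hg.continuousOn).restrict.comp_snd).pow_const p)
  calc ∫⁻ z in (ball 0 ((1 + 2 * ρ) / 3))ᶜ, ‖g z‖ₑ ^ p ∂ν
      ≤ ∫⁻ z in (ball 0 ((1 + 2 * ρ) / 3))ᶜ,
          C * ∫⁻ w in {w | ρ ≤ ‖w‖}, k z w ∂(weightedArea α) ∂ν := by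
        refine lintegral_mono_ae ?_
        filter_upwards [ae_restrict_of_ae hν,
          ae_restrict_mem Metric.isOpen_ball.measurableSet.compl] with z hz hzρ
        refine (hC g hg z hz).trans ?_
        gcongr
        intro w hw
        -- `|w - z| < (1 - |z|) / 2` gives `1 - |w| < 3 / 2 * (1 - |z|)`: hence `(1 + 2 * ρ) / 3`.
        have := one_sub_norm_lt hw
        rw [Set.mem_compl_iff, mem_ball_zero_iff, not_lt] at hzρ
        change ρ ≤ ‖w‖
        linarith
    _ = C * ∫⁻ w in {w | ρ ≤ ‖w‖}, ∫⁻ z in (ball 0 ((1 + 2 * ρ) / 3))ᶜ, k z w ∂ν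
          ∂(weightedArea α) := by
        rw [lintegral_const_mul' _ _ ENNReal.coe_ne_top, lintegral_lintegral_swap hk]
    _ ≤ _ := by
        refine mul_le_mul_right (lintegral_mono_ae ?_) _
        filter_upwards [ae_restrict_of_ae (weightedArea_ae_mem α)] with w hw
        refine (setLIntegral_le_lintegral _ _).trans_eq ?_
        have hw₁ : 0 ≤ 1 - ‖w‖ ^ 2 := by nlinarith [norm_nonneg w, mem_ball_zero_iff.1 hw]
        rw [lintegral_mul_const _ (by fun_prop), berezinTransform,
          ← lintegral_const_mul _ (by fun_prop)]
        simp only [ENNReal.ofReal_mul (Real.rpow_nonneg hw₁ _)]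

theorem exists_lintegral_compl_ball_le_of_berezinTransform_le (hp : 1 ≤ p) (hα : -1 < α)
    (hq : 0 ≤ q) :
    ∃ C : ℝ≥0, ∀ (ν : Measure ℂ) [SFinite ν], (∀ᵐ z ∂ν, ‖z‖ < 1) →
      ∀ (ρ : ℝ) (B : ℝ≥0∞), (∀ w, ρ ≤ ‖w‖ → ‖w‖ < 1 → berezinTransform α q ν w ≤ B) →
        ∀ g : ℂ → E, DifferentiableOn ℂ g (ball 0 1) →
          ∫⁻ z in (ball 0 ((1 + 2 * ρ) / 3))ᶜ, ‖g z‖ₑ ^ p ∂ν ≤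
            C * B * ∫⁻ w, ‖g w‖ₑ ^ p ∂(weightedArea α) := by
  obtain ⟨C, hC⟩ := exists_lintegral_compl_ball_le_berezinTransform (E := E) hp hα hq
  refine ⟨C, fun ν _ hν ρ B hB g hg => (hC ν hν g hg ρ).trans ?_⟩
  rw [mul_assoc]
  gcongr
  rw [← lintegral_const_mul'' _
    ((aemeasurable_enorm_weightedArea α hg.continuousOn).pow_const p)]
  refine (lintegral_mono_ae ?_).trans (setLIntegral_le_lintegral _ _)
  filter_upwards [ae_restrict_of_ae (weightedArea_ae_mem α),
    ae_restrict_mem (measurableSet_le measurable_const measurable_norm)] with w hw hwρ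
  gcongr
  exact hB w hwρ (mem_ball_zero_iff.1 hw)

lemma isFiniteMeasure_of_berezinTransform_ne_top {ν : Measure ℂ} (hν : ∀ᵐ z ∂ν, ‖z‖ < 1)
    (hq : 0 ≤ q) {w : ℂ} (hw : ‖w‖ < 1) (h : berezinTransform α q ν w ≠ ∞) :
    IsFiniteMeasure ν := by
  have hw₁ : 0 < 1 - ‖w‖ ^ 2 := by nlinarith [norm_nonneg w]
  have hker : ∫⁻ z, ENNReal.ofReal (‖1 - conj w * z‖ ^ (-q)) ∂ν < ∞ :=
    (ENNReal.lt_top_of_mul_ne_top_right h (by simpa using Real.rpow_pos_of_pos hw₁ _))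
  have hle : ENNReal.ofReal (2 ^ (-q)) * ν Set.univ ≤
      ∫⁻ z, ENNReal.ofReal (‖1 - conj w * z‖ ^ (-q)) ∂ν := by
    rw [← lintegral_const]
    refine lintegral_mono_ae ?_
    filter_upwards [hν] with z hz
    refine ENNReal.ofReal_le_ofReal (Real.rpow_le_rpow_of_nonpos ?_ ?_ (by linarith))
    · linarith [one_sub_norm_le_norm_one_sub_conj_mul z hw.le]
    · have := norm_sub_le (1 : ℂ) (conj w * z)
      rw [norm_mul, RCLike.norm_conj, norm_one] at this
      nlinarith [norm_nonneg z]
  exact ⟨ENNReal.lt_top_of_mul_ne_top_right (hle.trans_lt hker).ne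
    (by simpa using Real.rpow_pos_of_pos zero_lt_two (-q))⟩

end Carleson

section PointEvaluations

variable {p α R : ℝ}

lemma coe_rpow_one_div_rpow (hp : 0 < p) (C : ℝ≥0) : ((C ^ (1 / p) : ℝ≥0) : ℝ≥0∞) ^ p = C := by
  rw [← ENNReal.coe_rpow_of_nonneg _ hp.le, ← NNReal.rpow_mul, one_div_mul_cancel hp.ne',
    NNReal.rpow_one]

lemma dirichletENorm_rpow (hp : p ≠ 0) (α : ℝ) (f : 𝔻 → ℂ) :
    dirichletENorm p α f ^ p = ‖f 0‖ₑ ^ p + ∫⁻ z, ‖derivDisc f z‖ₑ ^ p ∂(weightedArea α) := by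
  rw [dirichletENorm, ← ENNReal.rpow_mul, one_div_mul_cancel hp, ENNReal.rpow_one]

lemma enorm_apply_zero_le_dirichletENorm (hp : 0 < p) (α : ℝ) (f : 𝔻 → ℂ) :
    ‖f 0‖ₑ ≤ dirichletENorm p α f := by
  rw [← ENNReal.rpow_le_rpow_iff hp, dirichletENorm_rpow hp.ne']
  exact le_self_add

lemma lintegral_derivDisc_rpow_le (hp : p ≠ 0) (α : ℝ) (f : 𝔻 → ℂ) :
    ∫⁻ z, ‖derivDisc f z‖ₑ ^ p ∂(weightedArea α) ≤ dirichletENorm p α f ^ p := by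
  rw [dirichletENorm_rpow hp]
  exact le_add_self

lemma IsHolo.differentiableOn_derivDisc {f : 𝔻 → ℂ} (hf : IsHolo f) :
    DifferentiableOn ℂ (derivDisc f) (ball 0 1) :=
  DifferentiableOn.deriv hf Metric.isOpen_ball

lemma exists_enorm_derivDisc_le_dirichletENorm (hp : 1 ≤ p) (hα : -1 < α) (hR : R < 1) :
    ∃ C : ℝ≥0, ∀ f, IsHolo f → ∀ z : ℂ, ‖z‖ ≤ R →
      ‖derivDisc f z‖ₑ ≤ C * dirichletENorm p α f := by
  have hp₀ : 0 < p := by linarith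
  obtain ⟨C, hC⟩ := exists_enorm_rpow_le_lintegral_weightedArea (E := ℂ) hp hα hR
  refine ⟨C ^ (1 / p), fun f hf z hz => ?_⟩
  rw [← ENNReal.rpow_le_rpow_iff hp₀, ENNReal.mul_rpow_of_nonneg _ _ hp₀.le,
    coe_rpow_one_div_rpow hp₀]
  exact (hC _ hf.differentiableOn_derivDisc z hz).trans
    (mul_le_mul_right (lintegral_derivDisc_rpow_le hp₀.ne' α f) _)

lemma exists_lipschitzOnWith_extendZero (hp : 1 ≤ p) (hα : -1 < α) (hR : R < 1) :
    ∃ C : ℝ≥0, ∀ f, MemDirichlet p α f →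
      LipschitzOnWith (C * (dirichletENorm p α f).toNNReal) (extendZero f)
        (Metric.closedBall 0 R) := by
  obtain ⟨C, hC⟩ := exists_enorm_derivDisc_le_dirichletENorm hp hα hR
  refine ⟨C, fun f hf => Convex.lipschitzOnWith_of_nnnorm_deriv_le (𝕜 := ℂ) (fun z hz => ?_)
    (fun z hz => ?_) (convex_closedBall 0 R)⟩
  · exact hf.1.differentiableAt (Metric.closedBall_subset_ball hR hz)
  · have h := hC f hf.1 z (mem_closedBall_zero_iff.1 hz)
    rw [← ENNReal.coe_toNNReal hf.2.ne] at h
    exact_mod_cast h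

lemma exists_enorm_extendZero_le_dirichletENorm (hp : 1 ≤ p) (hα : -1 < α) (hR : R < 1) :
    ∃ C : ℝ≥0, ∀ f, MemDirichlet p α f → ∀ z : ℂ, ‖z‖ ≤ R →
      ‖extendZero f z‖ₑ ≤ C * dirichletENorm p α f := by
  obtain ⟨C, hC⟩ := exists_lipschitzOnWith_extendZero hp hα hR
  refine ⟨C + 1, fun f hf z hz => ?_⟩
  have hlip : edist (extendZero f z) (f 0) ≤ C * dirichletENorm p α f * edist z 0 := by
    have h := hC f hf (mem_closedBall_zero_iff.2 hz)
      (Metric.mem_closedBall_self ((norm_nonneg z).trans hz))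
    rwa [← Complex.UnitDisc.coe_zero, extendZero_coe, ENNReal.coe_mul,
      ENNReal.coe_toNNReal hf.2.ne] at h
  have hz₁ : edist z 0 ≤ 1 := by
    rw [edist_zero_right, ← ofReal_norm, ENNReal.ofReal_le_one]
    linarith
  calc ‖extendZero f z‖ₑ ≤ edist (extendZero f z) (f 0) + ‖f 0‖ₑ := by
        simpa only [edist_zero_right] using edist_triangle (extendZero f z) (f 0) 0
    _ ≤ C * dirichletENorm p α f * 1 + dirichletENorm p α f := by
        gcongr
        · exact hlip.trans (by gcongr)
        · exact enorm_apply_zero_le_dirichletENorm (by linarith) α f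
    _ = (C + 1 : ℝ≥0) * dirichletENorm p α f := by
        push_cast
        ring

end PointEvaluations

section Composition

variable {p α : ℝ} {f : 𝔻 → ℂ} {φ : 𝔻 → 𝔻}

lemma extendZero_mk (f : 𝔻 → ℂ) {z : ℂ} (hz : ‖z‖ < 1) :
    extendZero f z = f (Complex.UnitDisc.mk z hz) :=
  dif_pos hz

lemma norm_extendZero_selfMap_lt_one (φ : 𝔻 → 𝔻) (z : ℂ) :
    ‖extendZero (fun z => (φ z : ℂ)) z‖ < 1 := by
  by_cases h : ‖z‖ < 1
  · rw [extendZero_mk _ h]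
    exact (φ _).norm_lt_one
  · simp [extendZero, h]

lemma extendZero_comp (f : 𝔻 → ℂ) (φ : 𝔻 → 𝔻) {z : ℂ} (hz : ‖z‖ < 1) :
    extendZero (f ∘ φ) z = extendZero f (extendZero (fun z => (φ z : ℂ)) z) := by
  rw [extendZero_mk _ hz, extendZero_mk _ hz, extendZero_coe]
  rfl

lemma IsHolo.comp (hf : IsHolo f) (hφ : IsHolo fun z => (φ z : ℂ)) : IsHolo (f ∘ φ) :=
  (DifferentiableOn.comp hf hφ fun z _ =>
    mem_ball_zero_iff.2 (norm_extendZero_selfMap_lt_one φ z)).congr fun _ hz =>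
      extendZero_comp f φ (mem_ball_zero_iff.1 hz)

lemma derivDisc_comp (hf : IsHolo f) (hφ : IsHolo fun z => (φ z : ℂ)) {z : ℂ}
    (hz : z ∈ ball (0 : ℂ) 1) :
    derivDisc (f ∘ φ) z =
      derivDisc f (extendZero (fun z => (φ z : ℂ)) z) * derivDisc (fun z => (φ z : ℂ)) z := by
  have h : extendZero (f ∘ φ) =ᶠ[𝓝 z] extendZero f ∘ extendZero (fun z => (φ z : ℂ)) := by
    filter_upwards [Metric.isOpen_ball.mem_nhds hz] with w hw
    exact extendZero_comp f φ (mem_ball_zero_iff.1 hw)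
  rw [derivDisc, h.deriv_eq, deriv_comp z
    (hf.differentiableAt (mem_ball_zero_iff.2 (norm_extendZero_selfMap_lt_one φ z)))
    (hφ.differentiableAt hz)]
  rfl

lemma IsHolo.measurable_extendZero (hf : IsHolo f) : Measurable (extendZero f) := by
  classical
  convert (DifferentiableOn.continuousOn hf).measurable_piecewise
    (continuousOn_const (c := (0 : ℂ))) Metric.isOpen_ball.measurableSet using 1
  funext z
  by_cases hz : ‖z‖ < 1 <;> simp [Set.piecewise, extendZero, hz]

/-- The image of the measure `|φ'|^p dA_α` under `φ`: the measure `ν` on the disc for which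
`∫ |(f ∘ φ)'|^p dA_α = ∫ |f'|^p dν`. -/
def imageMeasure (p α : ℝ) (φ : 𝔻 → 𝔻) : Measure ℂ :=
  ((weightedArea α).withDensity fun z => ‖derivDisc (fun z => (φ z : ℂ)) z‖ₑ ^ p).map
    (extendZero fun z => (φ z : ℂ))

instance (p α : ℝ) (φ : 𝔻 → 𝔻) : SFinite (imageMeasure p α φ) := by
  unfold imageMeasure
  infer_instance

lemma ae_imageMeasure_norm_lt_one (p α : ℝ) (hφ : IsHolo fun z => (φ z : ℂ)) :
    ∀ᵐ z ∂(imageMeasure p α φ), ‖z‖ < 1 := by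
  rw [imageMeasure, ae_map_iff hφ.measurable_extendZero.aemeasurable
    (measurableSet_lt measurable_norm measurable_const)]
  exact .of_forall fun z => norm_extendZero_selfMap_lt_one φ z

lemma lintegral_derivDisc_comp (hp : 0 ≤ p) (hf : IsHolo f) (hφ : IsHolo fun z => (φ z : ℂ)) :
    ∫⁻ z, ‖derivDisc (f ∘ φ) z‖ₑ ^ p ∂(weightedArea α) =
      ∫⁻ z, ‖derivDisc f z‖ₑ ^ p ∂(imageMeasure p α φ) := by
  have hf' := (measurable_derivDisc f).enorm.pow_const p
  have hφ' := (measurable_derivDisc fun z => (φ z : ℂ)).enorm.pow_const p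
  have hφm := hφ.measurable_extendZero
  have hcomp : Measurable fun z => ‖derivDisc f (extendZero (fun z => (φ z : ℂ)) z)‖ₑ ^ p :=
    hf'.comp hφm
  rw [imageMeasure, lintegral_map hf' hφm,
    lintegral_withDensity_eq_lintegral_mul _ hφ' hcomp]
  refine lintegral_congr_ae ?_
  filter_upwards [weightedArea_ae_mem α] with z hz
  rw [derivDisc_comp hf hφ hz, enorm_mul, ENNReal.mul_rpow_of_nonneg _ _ hp, mul_comm]
  rfl

lemma dirichletENorm_comp_rpow (hp : 0 < p) (hf : IsHolo f) (hφ : IsHolo fun z => (φ z : ℂ)) :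
    dirichletENorm p α (f ∘ φ) ^ p =
      ‖f (φ 0)‖ₑ ^ p + ∫⁻ z, ‖derivDisc f z‖ₑ ^ p ∂(imageMeasure p α φ) := by
  rw [dirichletENorm_rpow hp.ne', lintegral_derivDisc_comp hp.le hf hφ]
  rfl

lemma extendZero_coe_eqOn : Set.EqOn (extendZero fun z : 𝔻 => (z : ℂ)) id (ball 0 1) :=
  fun _ hz => extendZero_mk _ (mem_ball_zero_iff.1 hz)

lemma isHolo_coe : IsHolo fun z : 𝔻 => (z : ℂ) :=
  differentiableOn_id.congr extendZero_coe_eqOn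

lemma imageMeasure_id (p α : ℝ) : imageMeasure p α id = weightedArea α := by
  have hderiv : (fun z => ‖derivDisc (fun z : 𝔻 => (z : ℂ)) z‖ₑ ^ p) =ᵐ[weightedArea α] 1 := by
    filter_upwards [weightedArea_ae_mem α] with z hz
    rw [derivDisc, (extendZero_coe_eqOn.eventuallyEq_of_mem
      (Metric.isOpen_ball.mem_nhds hz)).deriv_eq, deriv_id]
    simp
  have hid : (extendZero fun z : 𝔻 => (z : ℂ)) =ᵐ[weightedArea α] id := by
    filter_upwards [weightedArea_ae_mem α] with z hz using extendZero_coe_eqOn hz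
  simp only [imageMeasure, id]
  rw [withDensity_congr_ae hderiv, withDensity_one, Measure.map_congr hid, Measure.map_id]

end Composition

section TestFunctions

variable {p α β : ℝ} {φ : 𝔻 → 𝔻}

lemma hasDerivAt_extendZero_testFun (l : 𝔻) (β : ℝ) {z : ℂ} (hz : ‖z‖ < 1) :
    HasDerivAt (extendZero (testFun l β))
      (((1 + β : ℝ) : ℂ) * conj (l : ℂ) * (1 - conj (l : ℂ) * z) ^ ((-(2 + β) : ℝ) : ℂ)) z := by
  have hev : extendZero (testFun l β) =ᶠ[𝓝 z]
      fun w => (1 - conj (l : ℂ) * w) ^ (-((1 + β : ℝ) : ℂ)) := by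
    filter_upwards [Metric.isOpen_ball.mem_nhds (mem_ball_zero_iff.2 hz)] with w hw
    rw [extendZero_mk _ (mem_ball_zero_iff.1 hw), testFun, Complex.cpow_neg, one_div]
    rfl
  have hslit : 1 - conj (l : ℂ) * z ∈ Complex.slitPlane := by
    rw [sub_eq_add_neg]
    refine Complex.mem_slitPlane_of_norm_lt_one ?_
    rw [norm_neg, norm_mul, RCLike.norm_conj]
    nlinarith [norm_nonneg z, l.norm_lt_one, norm_nonneg (l : ℂ)]
  have hbase : HasDerivAt (fun w : ℂ => 1 - conj (l : ℂ) * w) (-(conj (l : ℂ))) z := by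
    simpa using ((hasDerivAt_id z).const_mul (conj (l : ℂ))).const_sub 1
  refine ((hbase.cpow_const hslit).congr_deriv ?_).congr_of_eventuallyEq hev
  rw [show -((1 + β : ℝ) : ℂ) - 1 = ((-(2 + β) : ℝ) : ℂ) by push_cast; ring]
  ring

lemma isHolo_testFun (l : 𝔻) (β : ℝ) : IsHolo (testFun l β) := fun _ hz =>
  (hasDerivAt_extendZero_testFun l β
    (mem_ball_zero_iff.1 hz)).differentiableAt.differentiableWithinAt

lemma enorm_derivDisc_testFun_rpow (hp : 0 ≤ p) (l : 𝔻) (β : ℝ) {z : ℂ} (hz : ‖z‖ < 1) :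
    ‖derivDisc (testFun l β) z‖ₑ ^ p = ENNReal.ofReal (|1 + β| * ‖(l : ℂ)‖) ^ p *
      ENNReal.ofReal (‖1 - conj (l : ℂ) * z‖ ^ (-((2 + β) * p))) := by
  rw [derivDisc, (hasDerivAt_extendZero_testFun l β hz).deriv, ← ofReal_norm, norm_mul, norm_mul,
    Complex.norm_cpow_real, RCLike.norm_conj, Complex.norm_real, Real.norm_eq_abs,
    ENNReal.ofReal_mul (by positivity), ENNReal.mul_rpow_of_nonneg _ _ hp,
    ENNReal.ofReal_rpow_of_nonneg (Real.rpow_nonneg (norm_nonneg _) _) hp,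
    ← Real.rpow_mul (norm_nonneg _), neg_mul]

lemma ofReal_one_sub_sq_rpow_rpow (hp : 0 < p) (α β : ℝ) (l : 𝔻) :
    ENNReal.ofReal ((1 - ‖(l : ℂ)‖ ^ 2) ^ (2 + β - (2 + α) / p)) ^ p =
      ENNReal.ofReal ((1 - ‖(l : ℂ)‖ ^ 2) ^ ((2 + β) * p - (2 + α))) := by
  have hl : 0 ≤ 1 - ‖(l : ℂ)‖ ^ 2 := by linarith [l.sq_norm_lt_one]
  rw [ENNReal.ofReal_rpow_of_nonneg (Real.rpow_nonneg hl _) hp.le, ← Real.rpow_mul hl]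
  congr 2
  field_simp

lemma testQuantity_rpow (hp : 0 < p) (α β : ℝ) (hφ : IsHolo fun z => (φ z : ℂ)) (l : 𝔻) :
    testQuantity p α β φ l ^ p =
      ENNReal.ofReal ((1 - ‖(l : ℂ)‖ ^ 2) ^ ((2 + β) * p - (2 + α))) *
          ‖testFun l β (φ 0)‖ₑ ^ p +
        ENNReal.ofReal (|1 + β| * ‖(l : ℂ)‖) ^ p *
          berezinTransform α ((2 + β) * p) (imageMeasure p α φ) l := by
  have hderiv : ∫⁻ z, ‖derivDisc (testFun l β) z‖ₑ ^ p ∂(imageMeasure p α φ) =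
      ENNReal.ofReal (|1 + β| * ‖(l : ℂ)‖) ^ p *
        ∫⁻ z, ENNReal.ofReal (‖1 - conj (l : ℂ) * z‖ ^ (-((2 + β) * p)))
          ∂(imageMeasure p α φ) := by
    rw [← lintegral_const_mul _ (by fun_prop)]
    refine lintegral_congr_ae ?_
    filter_upwards [ae_imageMeasure_norm_lt_one p α hφ] with z hz
    exact enorm_derivDisc_testFun_rpow hp.le l β hz
  rw [testQuantity, ENNReal.mul_rpow_of_nonneg _ _ hp.le, ofReal_one_sub_sq_rpow_rpow hp,
    dirichletENorm_comp_rpow hp (isHolo_testFun l β) hφ, hderiv, berezinTransform]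
  ring

lemma berezinTransform_imageMeasure_le (hp : 0 < p) (α : ℝ) (hβ : β ≠ -1)
    (hφ : IsHolo fun z => (φ z : ℂ)) {l : 𝔻} (hl : 1 / 2 ≤ ‖(l : ℂ)‖) :
    berezinTransform α ((2 + β) * p) (imageMeasure p α φ) l ≤
      (ENNReal.ofReal (2 / |1 + β|) * testQuantity p α β φ l) ^ p := by
  have hβ₁ : 0 < |1 + β| := abs_pos.2 fun h => hβ (by linarith)
  have hone : 1 ≤ ENNReal.ofReal (2 / |1 + β|) * ENNReal.ofReal (|1 + β| * ‖(l : ℂ)‖) := by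
    rw [← ENNReal.ofReal_mul (by positivity), ENNReal.one_le_ofReal, ← mul_assoc,
      div_mul_cancel₀ _ hβ₁.ne']
    linarith
  rw [ENNReal.mul_rpow_of_nonneg _ _ hp.le, testQuantity_rpow hp α β hφ, mul_add, ← mul_assoc,
    ← mul_assoc, ← ENNReal.mul_rpow_of_nonneg _ _ hp.le]
  exact (le_mul_of_one_le_left' (ENNReal.one_le_rpow hone hp)).trans le_add_self

lemma two_add_lt_mul_of_pos (hp : 0 < p) (hδ : 0 < 2 + β - (2 + α) / p) :
    2 + α < (2 + β) * p :=
  (div_lt_iff₀ hp).1 (by linarith)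

lemma exists_testQuantity_id_le (hp : 0 < p) (hα : -1 < α) (hδ : 0 < 2 + β - (2 + α) / p) :
    ∃ C : ℝ≥0, ∀ l, testQuantity p α β id l ≤ C := by
  have hq := two_add_lt_mul_of_pos hp hδ
  obtain ⟨C, hC⟩ := exists_berezinTransform_weightedArea_le hα hq
  refine ⟨(1 + |1 + β|.toNNReal ^ p * C) ^ (1 / p), fun l => ?_⟩
  have hl := l.norm_lt_one
  have hl₀ := norm_nonneg (l : ℂ)
  rw [← ENNReal.rpow_le_rpow_iff hp, testQuantity_rpow hp α β (φ := id) isHolo_coe, id,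
    imageMeasure_id, coe_rpow_one_div_rpow hp, ENNReal.coe_add, ENNReal.coe_mul,
    ENNReal.coe_rpow_of_nonneg _ hp.le]
  gcongr
  · have htest : testFun l β 0 = 1 := by simp [testFun]
    rw [htest, enorm_one, ENNReal.one_rpow, mul_one, ENNReal.coe_one, ENNReal.ofReal_le_one]
    exact Real.rpow_le_one (by nlinarith) (by nlinarith) (by linarith)
  · exact ENNReal.ofReal_le_ofReal (mul_le_of_le_one_right (abs_nonneg _) hl.le)
  · exact hC l hl

end TestFunctions

section NormalizedTestFunctions

variable {p α β : ℝ} {φ : 𝔻 → 𝔻}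

/-- The test function `F_{λ,β}` multiplied by `(1 - |λ|²)^δ`, where `δ = 2 + β - (2 + α) / p`: this
factor makes its norm in `𝓓^p_α` bounded in `λ`. -/
def normalizedTestFun (p α β : ℝ) (l : 𝔻) : 𝔻 → ℂ :=
  (((1 - ‖(l : ℂ)‖ ^ 2) ^ (2 + β - (2 + α) / p) : ℝ) : ℂ) • testFun l β

lemma dirichletENorm_normalizedTestFun_comp (hp : 1 ≤ p) (hφ : IsHolo fun z => (φ z : ℂ))
    (l : 𝔻) : dirichletENorm p α (normalizedTestFun p α β l ∘ φ) = testQuantity p α β φ l := by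
  have hl : 0 ≤ 1 - ‖(l : ℂ)‖ ^ 2 := by linarith [l.sq_norm_lt_one]
  have h := dirichletENorm_smul hp α
    (((1 - ‖(l : ℂ)‖ ^ 2) ^ (2 + β - (2 + α) / p) : ℝ) : ℂ) ((isHolo_testFun l β).comp hφ)
  rwa [← ofReal_norm, Complex.norm_real, Real.norm_of_nonneg (Real.rpow_nonneg hl _)] at h

lemma isHolo_normalizedTestFun (p α β : ℝ) (l : 𝔻) : IsHolo (normalizedTestFun p α β l) := by
  unfold IsHolo normalizedTestFun
  rw [extendZero_smul]
  exact DifferentiableOn.const_smul (isHolo_testFun l β) _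

lemma exists_dirichletENorm_normalizedTestFun_le (hp : 1 ≤ p) (hα : -1 < α)
    (hδ : 0 < 2 + β - (2 + α) / p) :
    ∃ C : ℝ≥0, ∀ l, dirichletENorm p α (normalizedTestFun p α β l) ≤ C := by
  obtain ⟨C, hC⟩ := exists_testQuantity_id_le (by linarith) hα hδ
  exact ⟨C, fun l => (dirichletENorm_normalizedTestFun_comp (φ := id) hp isHolo_coe l).trans_le
    (hC l)⟩

lemma memDirichlet_normalizedTestFun (hp : 1 ≤ p) (hα : -1 < α)
    (hδ : 0 < 2 + β - (2 + α) / p) (l : 𝔻) : MemDirichlet p α (normalizedTestFun p α β l) := by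
  obtain ⟨C, hC⟩ := exists_dirichletENorm_normalizedTestFun_le hp hα hδ
  exact ⟨isHolo_normalizedTestFun p α β l, (hC l).trans_lt ENNReal.coe_lt_top⟩

lemma exists_norm_testFun_apply_le (β : ℝ) (z : 𝔻) : ∃ C : ℝ, ∀ l : 𝔻, ‖testFun l β z‖ ≤ C := by
  have hz := z.norm_lt_one
  obtain ⟨C, hC⟩ := isCompact_Icc.exists_bound_of_continuousOn
    (f := fun x : ℝ => x ^ (-(1 + β))) (s := Set.Icc (1 - ‖(z : ℂ)‖) 2) fun x hx =>
      (Real.continuousAt_rpow_const x _ (.inl (by linarith [hx.1]))).continuousWithinAt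
  refine ⟨C, fun l => ?_⟩
  have hle : ‖1 - conj (l : ℂ) * z‖ ≤ 2 := by
    refine (norm_sub_le _ _).trans ?_
    rw [norm_one, norm_mul, RCLike.norm_conj]
    nlinarith [l.norm_lt_one, norm_nonneg (l : ℂ)]
  have h := hC _ ⟨one_sub_norm_le_norm_one_sub_conj_mul (z : ℂ) l.norm_lt_one.le, hle⟩
  rwa [Real.norm_of_nonneg (Real.rpow_nonneg (norm_nonneg _) _), Real.rpow_neg (norm_nonneg _),
    ← Complex.norm_cpow_real, ← norm_inv, ← one_div] at h

lemma tendsto_normalizedTestFun_apply (hδ : 0 < 2 + β - (2 + α) / p) (z : 𝔻) :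
    Tendsto (fun l => normalizedTestFun p α β l z) (comap (fun l : 𝔻 => ‖(l : ℂ)‖) (𝓝 1))
      (𝓝 0) := by
  obtain ⟨C, hC⟩ := exists_norm_testFun_apply_le β z
  have hfactor : Tendsto (fun l : 𝔻 => (1 - ‖(l : ℂ)‖ ^ 2) ^ (2 + β - (2 + α) / p))
      (comap (fun l : 𝔻 => ‖(l : ℂ)‖) (𝓝 1)) (𝓝 0) := by
    have h : Tendsto (fun l : 𝔻 => 1 - ‖(l : ℂ)‖ ^ 2) (comap (fun l : 𝔻 => ‖(l : ℂ)‖) (𝓝 1))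
        (𝓝 (1 - 1 ^ 2)) := tendsto_const_nhds.sub (tendsto_comap.pow 2)
    simpa only [one_pow, sub_self, Real.zero_rpow hδ.ne'] using h.rpow_const (Or.inr hδ.le)
  refine squeeze_zero_norm (fun l => ?_) (by simpa only [zero_mul] using hfactor.mul_const C)
  have hl : 0 ≤ 1 - ‖(l : ℂ)‖ ^ 2 := by linarith [l.sq_norm_lt_one]
  rw [normalizedTestFun, Pi.smul_apply, norm_smul, Complex.norm_real,
    Real.norm_of_nonneg (Real.rpow_nonneg hl _)]
  exact mul_le_mul_of_nonneg_left (hC l) (Real.rpow_nonneg hl _)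

end NormalizedTestFunctions

section Boundedness

variable {p α β ρ : ℝ} {φ : 𝔻 → 𝔻}

lemma exists_lintegral_imageMeasure_compl_ball_le (hp : 1 ≤ p) (hα : -1 < α)
    (hβ : β ≠ -1) (hδ : 0 < 2 + β - (2 + α) / p) :
    ∃ C : ℝ≥0, ∀ φ : 𝔻 → 𝔻, (IsHolo fun z => (φ z : ℂ)) → ∀ ρ : ℝ, 1 / 2 ≤ ρ → ∀ M : ℝ≥0∞,
      (∀ l : 𝔻, ρ ≤ ‖(l : ℂ)‖ → testQuantity p α β φ l ≤ M) → ∀ f, IsHolo f →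
      ∫⁻ z in (ball 0 ((1 + 2 * ρ) / 3))ᶜ, ‖derivDisc f z‖ₑ ^ p ∂(imageMeasure p α φ) ≤
        (C * M * dirichletENorm p α f) ^ p := by
  have hp₀ : 0 < p := by linarith
  have hq : 0 ≤ (2 + β) * p := by linarith [two_add_lt_mul_of_pos hp₀ hδ]
  obtain ⟨C, hC⟩ := exists_lintegral_compl_ball_le_of_berezinTransform_le (E := ℂ) hp hα hq
  refine ⟨C ^ (1 / p) * (2 / |1 + β|).toNNReal, fun φ hφ ρ hρ M hM f hf => ?_⟩
  calc ∫⁻ z in (ball 0 ((1 + 2 * ρ) / 3))ᶜ, ‖derivDisc f z‖ₑ ^ p ∂(imageMeasure p α φ)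
      ≤ C * (ENNReal.ofReal (2 / |1 + β|) * M) ^ p *
          ∫⁻ z, ‖derivDisc f z‖ₑ ^ p ∂(weightedArea α) := by
        refine hC _ (ae_imageMeasure_norm_lt_one p α hφ) ρ _ (fun w hw hw₁ => ?_) _
          hf.differentiableOn_derivDisc
        refine (berezinTransform_imageMeasure_le (l := .mk w hw₁) hp₀ α hβ hφ
          (hρ.trans hw)).trans ?_
        gcongr
        exact hM _ hw
    _ ≤ C * (ENNReal.ofReal (2 / |1 + β|) * M) ^ p * dirichletENorm p α f ^ p := by
        gcongr
        exact lintegral_derivDisc_rpow_le hp₀.ne' α f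
    _ = (↑(C ^ (1 / p) * (2 / |1 + β|).toNNReal) * M * dirichletENorm p α f) ^ p := by
        simp only [ENNReal.coe_mul, ENNReal.mul_rpow_of_nonneg _ _ hp₀.le,
          coe_rpow_one_div_rpow hp₀, mul_assoc]
        rfl

lemma isFiniteMeasure_imageMeasure (hp : 0 < p) (hβ : β ≠ -1) (hβ' : 0 ≤ 2 + β)
    (hφ : IsHolo fun z => (φ z : ℂ)) {l : 𝔻} (hl : 1 / 2 ≤ ‖(l : ℂ)‖)
    (h : testQuantity p α β φ l ≠ ∞) : IsFiniteMeasure (imageMeasure p α φ) :=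
  isFiniteMeasure_of_berezinTransform_ne_top (ae_imageMeasure_norm_lt_one p α hφ)
    (by positivity : 0 ≤ (2 + β) * p) l.norm_lt_one
    ((berezinTransform_imageMeasure_le hp α hβ hφ hl).trans_lt (by finiteness)).ne

lemma exists_lintegral_ball_derivDisc_le (hp : 1 ≤ p) (hα : -1 < α) {R : ℝ} (hR : R < 1)
    (ν : Measure ℂ) [IsFiniteMeasure ν] :
    ∃ C : ℝ≥0, ∀ f, IsHolo f →
      ∫⁻ z in ball 0 R, ‖derivDisc f z‖ₑ ^ p ∂ν ≤ (C * dirichletENorm p α f) ^ p := by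
  have hp₀ : 0 < p := by linarith
  obtain ⟨C, hC⟩ := exists_enorm_derivDisc_le_dirichletENorm hp hα hR
  refine ⟨(ν Set.univ).toNNReal ^ (1 / p) * C, fun f hf => ?_⟩
  calc ∫⁻ z in ball 0 R, ‖derivDisc f z‖ₑ ^ p ∂ν
      ≤ ∫⁻ _ in ball 0 R, (C * dirichletENorm p α f) ^ p ∂ν :=
        setLIntegral_mono' Metric.isOpen_ball.measurableSet fun z hz =>
          ENNReal.rpow_le_rpow (hC f hf z (mem_ball_zero_iff.1 hz).le) hp₀.le
    _ ≤ (C * dirichletENorm p α f) ^ p * ν Set.univ :=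
        (setLIntegral_le_lintegral _ _).trans_eq (lintegral_const _)
    _ = (↑((ν Set.univ).toNNReal ^ (1 / p) * C) * dirichletENorm p α f) ^ p := by
        simp only [ENNReal.coe_mul, ENNReal.mul_rpow_of_nonneg _ _ hp₀.le,
          coe_rpow_one_div_rpow hp₀, ENNReal.coe_toNNReal (measure_ne_top ν _)]
        ring

lemma isFiniteMeasure_imageMeasure_of_testQuantity_le (hp : 0 < p) (hα : -1 < α) (hβ : β ≠ -1)
    (hδ : 0 < 2 + β - (2 + α) / p) (hφ : IsHolo fun z => (φ z : ℂ))
    (hρ : 1 / 2 ≤ ρ) (hρ₁ : ρ < 1) {M : ℝ≥0}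
    (hM : ∀ l : 𝔻, ρ ≤ ‖(l : ℂ)‖ → testQuantity p α β φ l ≤ M) :
    IsFiniteMeasure (imageMeasure p α φ) := by
  have hnorm : ‖(ρ : ℂ)‖ = ρ := by rw [Complex.norm_real, Real.norm_of_nonneg (by linarith)]
  have hl : ρ ≤ ‖(Complex.UnitDisc.mk (ρ : ℂ) (hnorm.trans_lt hρ₁) : ℂ)‖ := hnorm.ge
  have hβ' : 0 < 2 + β :=
    pos_of_mul_pos_left (by linarith [two_add_lt_mul_of_pos hp hδ] : 0 < (2 + β) * p) hp.le
  exact isFiniteMeasure_imageMeasure hp hβ hβ'.le hφ (hρ.trans hl)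
    ((hM _ hl).trans_lt ENNReal.coe_lt_top).ne

theorem exists_dirichletENorm_comp_le (hp : 1 ≤ p) (hα : -1 < α) (hβ : β ≠ -1)
    (hδ : 0 < 2 + β - (2 + α) / p) (hφ : IsHolo fun z => (φ z : ℂ)) (hρ : 1 / 2 ≤ ρ)
    (hρ₁ : ρ < 1) {M : ℝ≥0}
    (hM : ∀ l : 𝔻, ρ ≤ ‖(l : ℂ)‖ → testQuantity p α β φ l ≤ M) :
    ∃ C : ℝ≥0, ∀ f, MemDirichlet p α f →
      dirichletENorm p α (f ∘ φ) ≤ C * dirichletENorm p α f := by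
  have hp₀ : 0 < p := by linarith
  have := isFiniteMeasure_imageMeasure_of_testQuantity_le hp₀ hα hβ hδ hφ hρ hρ₁ hM
  obtain ⟨C₀, hC₀⟩ := exists_enorm_extendZero_le_dirichletENorm hp hα (φ 0).norm_lt_one
  obtain ⟨C₁, hC₁⟩ := exists_lintegral_ball_derivDisc_le hp hα
    (R := (1 + 2 * ρ) / 3) (by linarith) (imageMeasure p α φ)
  obtain ⟨C₂, hC₂⟩ := exists_lintegral_imageMeasure_compl_ball_le hp hα hβ hδ
  refine ⟨C₀ + (C₁ + C₂ * M), fun f hf => ?_⟩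
  set N := dirichletENorm p α f
  have hpoint : ‖f (φ 0)‖ₑ ≤ C₀ * N := by
    simpa only [extendZero_coe] using hC₀ f hf (φ 0) le_rfl
  rw [← ENNReal.rpow_le_rpow_iff hp₀, dirichletENorm_comp_rpow hp₀ hf.1 hφ,
    ← lintegral_add_compl _ (Metric.isOpen_ball (x := (0 : ℂ))
      (ε := (1 + 2 * ρ) / 3)).measurableSet]
  calc _ ≤ (C₀ * N) ^ p + ((C₁ * N) ^ p + (C₂ * M * N) ^ p) := by
        gcongr
        · exact hC₁ f hf.1
        · exact hC₂ φ hφ ρ hρ M hM f hf.1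
    _ ≤ (C₀ * N + (C₁ * N + C₂ * M * N)) ^ p :=
        (add_le_add_right (ENNReal.add_rpow_le_rpow_add _ _ hp) _).trans
          (ENNReal.add_rpow_le_rpow_add _ _ hp)
    _ = (↑(C₀ + (C₁ + C₂ * M)) * N) ^ p := by
        push_cast
        ring_nf

variable [Fact (1 ≤ p)] [Fact (-1 < α)]

lemma enorm_dirichletSpace (f : DirichletSpace p α) : ‖f‖ₑ = dirichletENorm p α f := by
  rw [← ofReal_norm]
  exact ENNReal.ofReal_toReal f.2.2.ne

lemma compositionBounded_of_dirichletENorm_comp_le (hφ : IsHolo fun z => (φ z : ℂ)) {C : ℝ≥0}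
    (hC : ∀ f, MemDirichlet p α f → dirichletENorm p α (f ∘ φ) ≤ C * dirichletENorm p α f) :
    CompositionBounded p α φ := by
  let T : DirichletSpace p α →ₗ[ℂ] DirichletSpace p α :=
    { toFun f := ⟨f ∘ φ, f.2.1.comp hφ,
        (hC f f.2).trans_lt (ENNReal.mul_lt_top ENNReal.coe_lt_top f.2.2)⟩
      map_add' _ _ := rfl
      map_smul' _ _ := rfl }
  refine ⟨T.mkContinuous C fun f => ?_, fun _ => rfl⟩
  have h := ENNReal.toReal_mono (ENNReal.mul_ne_top ENNReal.coe_ne_top f.2.2.ne) (hC f f.2)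
  rwa [ENNReal.toReal_mul] at h

theorem compositionBounded_iff (hβ : β ≠ -1) (hδ : 0 < 2 + β - (2 + α) / p)
    (hφ : IsHolo fun z => (φ z : ℂ)) :
    CompositionBounded p α φ ↔ (⨆ l : 𝔻, testQuantity p α β φ l) < ⊤ := by
  have hp : 1 ≤ p := Fact.out
  have hα : -1 < α := Fact.out
  constructor
  · rintro ⟨T, hT⟩
    obtain ⟨C, hC⟩ := exists_dirichletENorm_normalizedTestFun_le hp hα hδ
    refine (iSup_le fun l => ?_).trans_lt
      (ENNReal.mul_lt_top (enorm_lt_top (x := T)) (ENNReal.coe_lt_top (r := C)))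
    let F : DirichletSpace p α :=
      ⟨normalizedTestFun p α β l, memDirichlet_normalizedTestFun hp hα hδ l⟩
    have hTF : ‖T F‖ₑ = testQuantity p α β φ l := by
      rw [enorm_dirichletSpace, hT, ← dirichletENorm_normalizedTestFun_comp hp hφ]
    rw [← hTF]
    exact T.le_opENorm_of_le ((enorm_dirichletSpace F).trans_le (hC l))
  · intro h
    obtain ⟨C, hC⟩ := exists_dirichletENorm_comp_le hp hα hβ hδ hφ le_rfl (by norm_num)
      (M := (⨆ l : 𝔻, testQuantity p α β φ l).toNNReal) fun l _ => by
        rw [ENNReal.coe_toNNReal h.ne]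
        exact le_iSup (testQuantity p α β φ) l
    exact compositionBounded_of_dirichletENorm_comp_le hφ hC

end Boundedness

section NormalFamilies

lemma extendZero_sub (f g : 𝔻 → ℂ) : extendZero (f - g) = extendZero f - extendZero g := by
  rw [eq_sub_iff_add_eq, ← extendZero_add, sub_add_cancel]

theorem exists_subseq_tendstoLocallyUniformly_of_equicontinuous {X E : Type*} [TopologicalSpace X]
    [WeaklyLocallyCompactSpace X] [SigmaCompactSpace X] [MetricSpace E] [ProperSpace E]
    {F : ℕ → X → E} (hF : Equicontinuous F)
    (hbdd : ∀ x, Bornology.IsBounded (Set.range fun n => F n x)) :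
    ∃ (g : X → E) (ψ : ℕ → ℕ), StrictMono ψ ∧
      TendstoLocallyUniformly (fun n => F (ψ n)) g atTop := by
  set A := closure (Set.range F)
  have hA : A.Equicontinuous := Set.Equicontinuous.closure (equicontinuous_iff_range.1 hF)
  have hA_compact : IsCompact A := by
    refine Pi.isCompact_closure_iff.2 fun x => ?_
    rw [← Set.range_comp]
    exact (hbdd x).isCompact_closure
  have hA_image : ContinuousMap.toFun '' {h : C(X, E) | ⇑h ∈ A} = A :=
    Set.Subset.antisymm (Set.image_subset_iff.2 fun _ hh => hh) fun h hh =>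
      ⟨⟨h, hA.continuous ⟨h, hh⟩⟩, hh, rfl⟩
  have hS : IsCompact {h : C(X, E) | ⇑h ∈ A} :=
    ArzelaAscoli.isCompact_of_equicontinuous _ (hA_image.symm ▸ hA_compact)
      (hA.comp fun h : {h : C(X, E) | ⇑h ∈ A} => ⟨⇑h.1, h.2⟩)
  obtain ⟨g, -, ψ, hψ, hg⟩ := hS.tendsto_subseq (x := fun n => ⟨F n, hF.continuous n⟩)
    fun n => subset_closure (Set.mem_range_self n)
  exact ⟨g, ψ, hψ, ContinuousMap.tendsto_iff_tendstoLocallyUniformly.1 hg⟩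

variable {p α : ℝ} {f : ℕ → 𝔻 → ℂ} {g : 𝔻 → ℂ} {B : ℝ≥0}

lemma equicontinuousOn_extendZero (hp : 1 ≤ p) (hα : -1 < α) (hf : ∀ n, IsHolo (f n))
    (hB : ∀ n, dirichletENorm p α (f n) ≤ B) :
    EquicontinuousOn (fun n => extendZero (f n)) (ball 0 1) := by
  intro z hz
  obtain ⟨R, hzR, hR⟩ := exists_between (mem_ball_zero_iff.1 hz)
  obtain ⟨C, hC⟩ := exists_lipschitzOnWith_extendZero hp hα hR
  have hlip : ∀ n, LipschitzOnWith (C * B) (extendZero (f n)) (Metric.closedBall 0 R) := fun n =>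
    (hC _ ⟨hf n, (hB n).trans_lt ENNReal.coe_lt_top⟩).weaken
      (mul_le_mul_right (ENNReal.toNNReal_mono ENNReal.coe_ne_top (hB n)) C)
  have hequi := (LipschitzOnWith.uniformEquicontinuousOn _ _ hlip).equicontinuousOn z
    (mem_closedBall_zero_iff.2 hzR.le)
  rw [EquicontinuousWithinAt, nhdsWithin_eq_nhds.2 (Metric.closedBall_mem_nhds_of_mem
    (mem_ball_zero_iff.2 hzR))] at hequi
  exact fun U hU => (hequi U hU).filter_mono nhdsWithin_le_nhds

theorem exists_subseq_tendstoLocallyUniformlyOn_of_dirichletENorm_le (hp : 1 ≤ p) (hα : -1 < α)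
    (hf : ∀ n, IsHolo (f n)) (hB : ∀ n, dirichletENorm p α (f n) ≤ B) :
    ∃ (g : 𝔻 → ℂ) (ψ : ℕ → ℕ), StrictMono ψ ∧
      TendstoLocallyUniformlyOn (fun n => extendZero (f (ψ n))) (extendZero g) atTop
        (ball 0 1) := by
  have : LocallyCompactSpace (ball (0 : ℂ) 1) := Metric.isOpen_ball.locallyCompactSpace
  obtain ⟨G, ψ, hψ, hG⟩ := exists_subseq_tendstoLocallyUniformly_of_equicontinuous
    (equicontinuous_restrict_iff _ |>.2 (equicontinuousOn_extendZero hp hα hf hB)) fun z => by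
      obtain ⟨C, hC⟩ := exists_enorm_extendZero_le_dirichletENorm hp hα
        (mem_ball_zero_iff.1 z.2)
      refine (Metric.isBounded_closedBall (x := (0 : ℂ)) (r := C * B)).subset ?_
      rintro _ ⟨n, rfl⟩
      have h := (hC (f n) ⟨hf n, (hB n).trans_lt ENNReal.coe_lt_top⟩ z le_rfl).trans
        (mul_le_mul_right (hB n) _)
      rw [mem_closedBall_zero_iff]
      exact_mod_cast h
  refine ⟨fun z => G ⟨z, mem_ball_zero_iff.2 z.norm_lt_one⟩, ψ, hψ, ?_⟩
  rw [tendstoLocallyUniformlyOn_iff_tendstoLocallyUniformly_comp_coe]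
  exact hG.congr_right fun z => (extendZero_mk _ (mem_ball_zero_iff.1 z.2)).symm

lemma isHolo_of_tendstoLocallyUniformlyOn (hf : ∀ n, IsHolo (f n))
    (hfg : TendstoLocallyUniformlyOn (fun n => extendZero (f n)) (extendZero g) atTop
      (ball 0 1)) : IsHolo g :=
  hfg.differentiableOn (.of_forall hf) Metric.isOpen_ball

lemma tendsto_apply_of_tendstoLocallyUniformlyOn
    (hfg : TendstoLocallyUniformlyOn (fun n => extendZero (f n)) (extendZero g) atTop (ball 0 1))
    (z : 𝔻) : Tendsto (fun n => f n z) atTop (𝓝 (g z)) := by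
  simpa only [extendZero_coe] using hfg.tendsto_at (mem_ball_zero_iff.2 z.norm_lt_one)

lemma tendsto_derivDisc_of_tendstoLocallyUniformlyOn (hf : ∀ n, IsHolo (f n))
    (hfg : TendstoLocallyUniformlyOn (fun n => extendZero (f n)) (extendZero g) atTop (ball 0 1))
    {z : ℂ} (hz : z ∈ ball (0 : ℂ) 1) :
    Tendsto (fun n => derivDisc (f n) z) atTop (𝓝 (derivDisc g z)) :=
  (hfg.deriv (.of_forall hf) Metric.isOpen_ball).tendsto_at hz

lemma tendstoLocallyUniformlyOn_extendZero_sub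
    (hfg : TendstoLocallyUniformlyOn (fun n => extendZero (f n)) (extendZero g) atTop
      (ball 0 1)) :
    TendstoLocallyUniformlyOn (fun n => extendZero (f n - g)) (extendZero 0) atTop (ball 0 1) := by
  have hconst : TendstoLocallyUniformlyOn (fun _ : ℕ => extendZero g) (extendZero g) atTop
      (ball 0 1) := fun _ hu _ _ =>
    ⟨_, self_mem_nhdsWithin, .of_forall fun _ _ _ => refl_mem_uniformity hu⟩
  have hsub := hfg.sub hconst
  rw [sub_self] at hsub
  simp only [extendZero_sub, extendZero_zero]
  exact hsub

lemma dirichletENorm_le_of_tendstoLocallyUniformlyOn (hp : 0 < p) (hf : ∀ n, IsHolo (f n))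
    (hfg : TendstoLocallyUniformlyOn (fun n => extendZero (f n)) (extendZero g) atTop (ball 0 1))
    (hB : ∀ n, dirichletENorm p α (f n) ≤ B) : dirichletENorm p α g ≤ B := by
  have hzero : Tendsto (fun n => ‖f n 0‖ₑ ^ p) atTop (𝓝 (‖g 0‖ₑ ^ p)) :=
    (tendsto_apply_of_tendstoLocallyUniformlyOn hfg 0).enorm.ennrpow_const p
  have hle : ∀ n, ‖f n 0‖ₑ ^ p + ∫⁻ z, ‖derivDisc (f n) z‖ₑ ^ p ∂(weightedArea α) ≤ B ^ p :=
    fun n => (dirichletENorm_rpow hp.ne' α (f n)).symm.trans_le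
      (ENNReal.rpow_le_rpow (hB n) hp.le)
  have hderiv : ∫⁻ z, ‖derivDisc g z‖ₑ ^ p ∂(weightedArea α) ≤ B ^ p - ‖g 0‖ₑ ^ p := by
    calc ∫⁻ z, ‖derivDisc g z‖ₑ ^ p ∂(weightedArea α)
        = ∫⁻ z, liminf (fun n => ‖derivDisc (f n) z‖ₑ ^ p) atTop ∂(weightedArea α) := by
          refine lintegral_congr_ae ?_
          filter_upwards [weightedArea_ae_mem α] with z hz
          exact ((tendsto_derivDisc_of_tendstoLocallyUniformlyOn hf hfg
            hz).enorm.ennrpow_const p).liminf_eq.symm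
      _ ≤ liminf (fun n => ∫⁻ z, ‖derivDisc (f n) z‖ₑ ^ p ∂(weightedArea α)) atTop :=
          lintegral_liminf_le fun n => (measurable_derivDisc _).enorm.pow_const p
      _ ≤ liminf (fun n => (B : ℝ≥0∞) ^ p - ‖f n 0‖ₑ ^ p) atTop :=
          liminf_le_liminf (.of_forall fun n =>
            ENNReal.le_sub_of_add_le_left (by finiteness) (hle n))
      _ = B ^ p - ‖g 0‖ₑ ^ p :=
          (ENNReal.Tendsto.sub tendsto_const_nhds hzero (.inr (by finiteness))).liminf_eq
  rw [← ENNReal.rpow_le_rpow_iff hp, dirichletENorm_rpow hp.ne']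
  refine (add_le_add_right hderiv _).trans (add_tsub_cancel_of_le ?_).le
  exact le_of_tendsto' hzero fun n => le_self_add.trans (hle n)

end NormalFamilies

section Compactness

variable {p α β : ℝ} {φ : 𝔻 → 𝔻} {f : ℕ → 𝔻 → ℂ} {B : ℝ≥0}

lemma exists_forall_of_eventually_comap_norm {P : 𝔻 → Prop}
    (h : ∀ᶠ l in comap (fun l : 𝔻 => ‖(l : ℂ)‖) (𝓝 1), P l) :
    ∃ ρ : ℝ, 1 / 2 ≤ ρ ∧ ρ < 1 ∧ ∀ l : 𝔻, ρ ≤ ‖(l : ℂ)‖ → P l := by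
  obtain ⟨s, hs₁, hs⟩ := exists_Ioc_subset_of_mem_nhds (eventually_comap.1 h) (exists_lt 1)
  obtain ⟨ρ, hsρ, hρ⟩ := exists_between (max_lt hs₁ (by norm_num : (1 / 2 : ℝ) < 1))
  exact ⟨ρ, (le_max_right _ _).trans hsρ.le, hρ, fun l hl =>
    hs ⟨((le_max_left _ _).trans_lt hsρ).trans_le hl, l.norm_lt_one.le⟩ l rfl⟩

lemma tendsto_lintegral_ball_derivDisc (hp : 1 ≤ p) (hα : -1 < α) (ν : Measure ℂ)
    [IsFiniteMeasure ν] {R : ℝ} (hR : R < 1) (hf : ∀ n, IsHolo (f n))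
    (hB : ∀ n, dirichletENorm p α (f n) ≤ B)
    (hf₀ : TendstoLocallyUniformlyOn (fun n => extendZero (f n)) (extendZero 0) atTop
      (ball 0 1)) :
    Tendsto (fun n => ∫⁻ z in ball 0 R, ‖derivDisc (f n) z‖ₑ ^ p ∂ν) atTop (𝓝 0) := by
  have hp₀ : 0 < p := by linarith
  obtain ⟨C, hC⟩ := exists_enorm_derivDisc_le_dirichletENorm hp hα hR
  have hmem : ∀ᵐ z ∂(ν.restrict (ball 0 R)), z ∈ ball (0 : ℂ) R :=
    ae_restrict_mem Metric.isOpen_ball.measurableSet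
  have hbound : ∀ n, ∀ᵐ z ∂(ν.restrict (ball 0 R)), ‖derivDisc (f n) z‖ₑ ^ p ≤ (C * B) ^ p := by
    intro n
    filter_upwards [hmem] with z hz
    exact ENNReal.rpow_le_rpow ((hC _ (hf n) z (mem_ball_zero_iff.1 hz).le).trans
      (mul_le_mul_right (hB n) _)) hp₀.le
  have hlim : ∀ᵐ z ∂(ν.restrict (ball 0 R)),
      Tendsto (fun n => ‖derivDisc (f n) z‖ₑ ^ p) atTop (𝓝 0) := by
    filter_upwards [hmem] with z hz
    have h := (tendsto_derivDisc_of_tendstoLocallyUniformlyOn hf hf₀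
      (Metric.ball_subset_ball hR.le hz)).enorm.ennrpow_const p
    rwa [derivDisc, extendZero_zero, deriv_zero, Pi.zero_apply, enorm_zero,
      ENNReal.zero_rpow_of_pos hp₀] at h
  simpa only [lintegral_zero] using tendsto_lintegral_of_dominated_convergence _
    (fun n => (measurable_derivDisc (f n)).enorm.pow_const p) hbound
    (by rw [lintegral_const]; finiteness) hlim

lemma exists_lintegral_compl_ball_le_of_tendsto_testQuantity (hp : 1 ≤ p) (hα : -1 < α)
    (hβ : β ≠ -1) (hδ : 0 < 2 + β - (2 + α) / p) (hφ : IsHolo fun z => (φ z : ℂ))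
    (h : Tendsto (testQuantity p α β φ) (comap (fun l : 𝔻 => ‖(l : ℂ)‖) (𝓝 1)) (𝓝 0)) (B : ℝ≥0)
    {ε : ℝ≥0∞} (hε : 0 < ε) :
    ∃ R < 1, ∀ f, IsHolo f → dirichletENorm p α f ≤ B →
      ∫⁻ z in (ball 0 R)ᶜ, ‖derivDisc f z‖ₑ ^ p ∂(imageMeasure p α φ) ≤ ε := by
  obtain ⟨C, hC⟩ := exists_lintegral_imageMeasure_compl_ball_le hp hα hβ hδ
  have hsmall : Tendsto (fun M : ℝ≥0∞ => (C * M * B) ^ p) (𝓝[>] 0) (𝓝 0) := by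
    have hlin : Tendsto (fun M : ℝ≥0∞ => C * M * B) (𝓝 0) (𝓝 (C * 0 * B)) :=
      ENNReal.Tendsto.mul_const (ENNReal.Tendsto.const_mul tendsto_id (.inr ENNReal.coe_ne_top))
        (.inr ENNReal.coe_ne_top)
    rw [mul_zero, zero_mul] at hlin
    simpa only [ENNReal.zero_rpow_of_pos (by linarith : 0 < p)] using
      (hlin.mono_left nhdsWithin_le_nhds).ennrpow_const p
  obtain ⟨M, hMε, hM⟩ := ((ENNReal.tendsto_nhds_zero.1 hsmall ε hε).and
    self_mem_nhdsWithin).exists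
  obtain ⟨ρ, hρ, hρ₁, hρM⟩ :=
    exists_forall_of_eventually_comap_norm (ENNReal.tendsto_nhds_zero.1 h M hM)
  exact ⟨(1 + 2 * ρ) / 3, by linarith, fun f hf hB => (hC φ hφ ρ hρ M hρM f hf).trans
    ((ENNReal.rpow_le_rpow (mul_le_mul_right hB _) (by linarith)).trans hMε)⟩

lemma isFiniteMeasure_imageMeasure_of_tendsto_testQuantity (hp : 0 < p) (hα : -1 < α)
    (hβ : β ≠ -1) (hδ : 0 < 2 + β - (2 + α) / p) (hφ : IsHolo fun z => (φ z : ℂ))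
    (h : Tendsto (testQuantity p α β φ) (comap (fun l : 𝔻 => ‖(l : ℂ)‖) (𝓝 1)) (𝓝 0)) :
    IsFiniteMeasure (imageMeasure p α φ) := by
  obtain ⟨ρ, hρ, hρ₁, hM⟩ :=
    exists_forall_of_eventually_comap_norm (ENNReal.tendsto_nhds_zero.1 h 1 one_pos)
  exact isFiniteMeasure_imageMeasure_of_testQuantity_le hp hα hβ hδ hφ hρ hρ₁ (M := 1) hM

theorem tendsto_dirichletENorm_comp (hp : 1 ≤ p) (hα : -1 < α) (hβ : β ≠ -1)
    (hδ : 0 < 2 + β - (2 + α) / p) (hφ : IsHolo fun z => (φ z : ℂ))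
    (h : Tendsto (testQuantity p α β φ) (comap (fun l : 𝔻 => ‖(l : ℂ)‖) (𝓝 1)) (𝓝 0))
    (hf : ∀ n, IsHolo (f n)) (hB : ∀ n, dirichletENorm p α (f n) ≤ B)
    (hf₀ : TendstoLocallyUniformlyOn (fun n => extendZero (f n)) (extendZero 0) atTop
      (ball 0 1)) :
    Tendsto (fun n => dirichletENorm p α (f n ∘ φ)) atTop (𝓝 0) := by
  have hp₀ : 0 < p := by linarith
  have := isFiniteMeasure_imageMeasure_of_tendsto_testQuantity hp₀ hα hβ hδ hφ h
  have hpoint : Tendsto (fun n => ‖f n (φ 0)‖ₑ ^ p) atTop (𝓝 0) := by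
    simpa only [Pi.zero_apply, enorm_zero, ENNReal.zero_rpow_of_pos hp₀] using
      (tendsto_apply_of_tendstoLocallyUniformlyOn hf₀ (φ 0)).enorm.ennrpow_const p
  have hint : Tendsto (fun n => ∫⁻ z, ‖derivDisc (f n) z‖ₑ ^ p ∂(imageMeasure p α φ)) atTop
      (𝓝 0) := by
    refine ENNReal.tendsto_nhds_zero.2 fun ε hε => ?_
    obtain ⟨R, hR, hcompl⟩ := exists_lintegral_compl_ball_le_of_tendsto_testQuantity hp hα hβ hδ
      hφ h B (ENNReal.half_pos hε.ne')
    filter_upwards [ENNReal.tendsto_nhds_zero.1 (tendsto_lintegral_ball_derivDisc hp hα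
      (imageMeasure p α φ) hR hf hB hf₀) (ε / 2) (ENNReal.half_pos hε.ne')] with n hn
    rw [← lintegral_add_compl _ (Metric.isOpen_ball (x := (0 : ℂ)) (ε := R)).measurableSet,
      ← ENNReal.add_halves ε]
    exact add_le_add hn (hcompl (f n) (hf n) (hB n))
  have hpow : Tendsto (fun n => dirichletENorm p α (f n ∘ φ) ^ p) atTop (𝓝 0) := by
    simpa only [dirichletENorm_comp_rpow hp₀ (hf _) hφ, add_zero] using hpoint.add hint
  simpa only [ENNReal.rpow_rpow_inv hp₀.ne', ENNReal.zero_rpow_of_pos (inv_pos.2 hp₀)] using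
    hpow.ennrpow_const p⁻¹

variable [Fact (1 ≤ p)] [Fact (-1 < α)]
  {T : DirichletSpace p α →L[ℂ] DirichletSpace p α}

theorem isCompactOperator_of_tendsto_testQuantity (hβ : β ≠ -1) (hδ : 0 < 2 + β - (2 + α) / p)
    (hφ : IsHolo fun z => (φ z : ℂ))
    (h : Tendsto (testQuantity p α β φ) (comap (fun l : 𝔻 => ‖(l : ℂ)‖) (𝓝 1)) (𝓝 0))
    (hT : ∀ f, (T f : 𝔻 → ℂ) = (f : 𝔻 → ℂ) ∘ φ) : IsCompactOperator T := by
  have hp : 1 ≤ p := Fact.out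
  have hα : -1 < α := Fact.out
  have hball : ∀ f : DirichletSpace p α, f ∈ Metric.closedBall 0 1 ↔
      dirichletENorm p α f ≤ (1 : ℝ≥0) := fun f => by
    rw [← enorm_dirichletSpace, enorm_le_coe, mem_closedBall_zero_iff, ← NNReal.coe_le_coe,
      coe_nnnorm, NNReal.coe_one]
  refine (isCompactOperator_iff_exists_mem_nhds_image_subset_compact _).2
    ⟨_, Metric.closedBall_mem_nhds 0 one_pos, T '' Metric.closedBall 0 1,
      IsSeqCompact.isCompact fun u hu => ?_, subset_rfl⟩
  choose F hF hFu using hu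
  have hF₁ := fun n => (hball (F n)).1 (hF n)
  obtain ⟨g, ψ, hψ, hFg⟩ :=
    exists_subseq_tendstoLocallyUniformlyOn_of_dirichletENorm_le hp hα (fun n => (F n).2.1) hF₁
  have hg := dirichletENorm_le_of_tendstoLocallyUniformlyOn (by linarith)
    (fun n => (F (ψ n)).2.1) hFg (fun n => hF₁ (ψ n))
  let G : DirichletSpace p α := ⟨g, isHolo_of_tendstoLocallyUniformlyOn
    (fun n => (F (ψ n)).2.1) hFg, hg.trans_lt ENNReal.coe_lt_top⟩
  refine ⟨T G, ⟨G, (hball G).2 hg, rfl⟩, ψ, hψ, ?_⟩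
  have hdiff : TendstoLocallyUniformlyOn (fun n => extendZero (F (ψ n) - G).1) (extendZero 0)
      atTop (ball 0 1) := tendstoLocallyUniformlyOn_extendZero_sub hFg
  have hbdd : ∀ n, dirichletENorm p α (F (ψ n) - G).1 ≤ (2 : ℝ≥0) := fun n => by
    rw [← enorm_dirichletSpace]
    refine enorm_sub_le.trans ?_
    rw [enorm_dirichletSpace, enorm_dirichletSpace]
    exact (add_le_add (hF₁ (ψ n)) hg).trans_eq (by norm_num)
  have hlim := tendsto_dirichletENorm_comp hp hα hβ hδ hφ h (fun n => (F (ψ n) - G).2.1) hbdd hdiff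
  refine tendsto_iff_edist_tendsto_0.2 (hlim.congr fun n => ?_)
  rw [edist_eq_enorm_sub, Function.comp_apply, ← hFu, ← map_sub, enorm_dirichletSpace, hT]

lemma tendsto_dirichletSpace_apply {u : ℕ → DirichletSpace p α} {g : DirichletSpace p α}
    (h : Tendsto u atTop (𝓝 g)) (z : 𝔻) :
    Tendsto (fun n => (u n : 𝔻 → ℂ) z) atTop (𝓝 ((g : 𝔻 → ℂ) z)) := by
  obtain ⟨C, hC⟩ := exists_enorm_extendZero_le_dirichletENorm (p := p) (α := α) Fact.out Fact.out
    z.norm_lt_one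
  rw [tendsto_iff_edist_tendsto_0] at h ⊢
  refine tendsto_of_tendsto_of_tendsto_of_le_of_le tendsto_const_nhds
    (by simpa only [mul_zero] using
      ENNReal.Tendsto.const_mul h (.inr (ENNReal.coe_ne_top (r := C))))
    (fun _ => zero_le) fun n => ?_
  have hn := hC (u n - g).1 (u n - g).2 z le_rfl
  rw [extendZero_coe, ← enorm_dirichletSpace, ← edist_eq_enorm_sub] at hn
  rw [edist_eq_enorm_sub]
  exact hn

theorem tendsto_testQuantity_of_isCompactOperator (hδ : 0 < 2 + β - (2 + α) / p)
    (hφ : IsHolo fun z => (φ z : ℂ)) (hT : ∀ f, (T f : 𝔻 → ℂ) = (f : 𝔻 → ℂ) ∘ φ)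
    (hc : IsCompactOperator T) :
    Tendsto (testQuantity p α β φ) (comap (fun l : 𝔻 => ‖(l : ℂ)‖) (𝓝 1)) (𝓝 0) := by
  have hp : 1 ≤ p := Fact.out
  have hα : -1 < α := Fact.out
  obtain ⟨C, hC⟩ := exists_dirichletENorm_normalizedTestFun_le hp hα hδ
  let F (l : 𝔻) : DirichletSpace p α :=
    ⟨normalizedTestFun p α β l, memDirichlet_normalizedTestFun hp hα hδ l⟩
  have hF : ∀ l, F l ∈ Metric.closedBall 0 (C : ℝ) := fun l => by
    have h := (enorm_dirichletSpace (F l)).trans_le (hC l)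
    rw [mem_closedBall_zero_iff]
    exact_mod_cast h
  refine tendsto_of_subseq_tendsto fun u hu => ?_
  obtain ⟨g, -, ψ, hψ, hg⟩ := (hc.isCompact_closure_image_closedBall C).tendsto_subseq
    fun n => subset_closure (Set.mem_image_of_mem T (hF (u n)))
  have hg₀ : g = 0 := by
    refine Subtype.ext (funext fun z => tendsto_nhds_unique (tendsto_dirichletSpace_apply hg z)
      (((tendsto_normalizedTestFun_apply hδ (φ z)).comp (hu.comp hψ.tendsto_atTop)).congr
        fun n => ?_))
    simp only [Function.comp_apply, hT]
    rfl
  have hlim := hg.enorm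
  rw [hg₀, enorm_zero] at hlim
  refine ⟨ψ, hlim.congr fun n => ?_⟩
  rw [Function.comp_apply, enorm_dirichletSpace, hT, ← dirichletENorm_normalizedTestFun_comp hp hφ]

theorem compositionCompact_iff (hβ : β ≠ -1) (hδ : 0 < 2 + β - (2 + α) / p)
    (hφ : IsHolo fun z => (φ z : ℂ)) :
    CompositionCompact p α φ ↔
      Tendsto (testQuantity p α β φ) (comap (fun l : 𝔻 => ‖(l : ℂ)‖) (𝓝 1)) (𝓝 0) := by
  refine ⟨fun ⟨T, hT, hc⟩ => tendsto_testQuantity_of_isCompactOperator hδ hφ hT hc, fun h => ?_⟩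
  obtain ⟨ρ, hρ, hρ₁, hM⟩ :=
    exists_forall_of_eventually_comap_norm (ENNReal.tendsto_nhds_zero.1 h 1 one_pos)
  obtain ⟨C, hC⟩ := exists_dirichletENorm_comp_le Fact.out Fact.out hβ hδ hφ hρ hρ₁ (M := 1) hM
  obtain ⟨T, hT⟩ := compositionBounded_of_dirichletENorm_comp_le hφ hC
  exact ⟨T, hT, isCompactOperator_of_tendsto_testQuantity hβ hδ hφ h hT⟩

end Compactness

end WeightedDirichlet

end

theorem mainTheorem1_general (p α β : ℝ) [Fact (1 ≤ p)] [Fact (-1 < α)] (hβ : β ≠ -1)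
    (hδ : 0 < 2 + β - (2 + α) / p) (φ : Complex.UnitDisc → Complex.UnitDisc)
    (hφ : WeightedDirichlet.IsHolo fun z => (φ z : ℂ)) :
    (WeightedDirichlet.CompositionBounded p α φ ↔
      (⨆ l : Complex.UnitDisc, WeightedDirichlet.testQuantity p α β φ l) < ⊤) ∧
    (WeightedDirichlet.CompositionCompact p α φ ↔
      Tendsto (WeightedDirichlet.testQuantity p α β φ)
        (comap (fun l : Complex.UnitDisc => ‖(l : ℂ)‖) (𝓝 1)) (𝓝 0)) :=
  ⟨WeightedDirichlet.compositionBounded_iff hβ hδ hφ,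
    WeightedDirichlet.compositionCompact_iff hβ hδ hφ⟩

theorem mainTheorem1 (p α β : ℝ) [Fact (1 ≤ p)] [Fact (-1 < α)] (hp : 1 < p) (hβ : 0 ≤ β)
    (hδ : 0 < 2 + β - (2 + α) / p) (φ : Complex.UnitDisc → Complex.UnitDisc)
    (hφ : WeightedDirichlet.MemDirichlet p α (fun z => (φ z : ℂ))) :
    (WeightedDirichlet.CompositionBounded p α φ ↔
      (⨆ l : Complex.UnitDisc, WeightedDirichlet.testQuantity p α β φ l) < ⊤) ∧
    (WeightedDirichlet.CompositionCompact p α φ ↔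
      Tendsto (WeightedDirichlet.testQuantity p α β φ)
        (comap (fun l : Complex.UnitDisc => ‖(l : ℂ)‖) (𝓝 1)) (𝓝 0)) :=
  mainTheorem1_general p α β (by linarith) hδ φ hφ.1
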